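/- All locally convex spaces are real and Hausdorff, and smoothness is understood in the sense of the Michal--Bastiani calculus: a map $f\colon U\to F$ on an open subset $U$ of a locally convex space $E$ is $C^0$ if it is continuous; it is $C^{n+1}$ if it is continuous, all directional derivatives $df(x)(v)$, $x\in U$, $v\in E$, exist, and $df\colon U\times E\to F$ is $C^n$; it is smooth if it is $C^n$ for all $n$. A Lie group is a group $G$ with a smooth manifold structure modelled on a locally convex space for which multiplication and inversion are smooth; its Lie algebra is $\mathfrak g=T_{\mathbf 1}(G)$ with the bracket $[x,y]=[x_l,y_l](\mathbf 1)$ of left invariant vector fields. A smooth $G$-module is a locally convex space $V$ with an action of $G$ by linear maps such that the action map $G\times V\to V$ is smooth; then $\mathfrak g$ acts on $V$ by the derived action $(x,v)\mapsto x.v$. The space $V$ is Mackey complete if for every smooth curve $\gamma\colon[0,1]\to V$ the integral $\int_0^1\gamma(t)\,dt$ exists in $V$. For $p\ge 0$ let $C^p(\mathfrak g,V)$ be the space of continuous alternating $p$-linear maps $\mathfrak g^p\to V$, let $$(\mathrm d_{\mathfrak g}\omega)(x_0,\dots,x_p)=\sum_{i}(-1)^i x_i.\omega(x_0,\dots,\widehat{x_i},\dots,x_p)+\sum_{i<j}(-1)^{i+j}\omega([x_i,x_j],x_0,\dots,\widehat{x_i},\dots,\widehat{x_j},\dots,x_p)$$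 be the Chevalley--Eilenberg differential, and let $H^p(\mathfrak g,V)=Z^p(\mathfrak g,V)/B^p(\mathfrak g,V)$ be the quotient of the space of cocycles by the space of coboundaries (with $B^0=0$). The group $G$ acts on $C^p(\mathfrak g,V)$ by $$(g.\omega)(x_1,\dots,x_p)=g.\omega\big(\mathrm{Ad}(g)^{-1}x_1,\dots,\mathrm{Ad}(g)^{-1}x_p\big).$$ **Theorem.** Let $G$ be a connected Lie group with Lie algebra $\mathfrak g$ and $V$ a Mackey complete smooth $G$-module. Then for every $p\ge 0$ the action of $G$ on $C^p(\mathfrak g,V)$ preserves cocycles and coboundaries, and the induced natural action of $G$ on the continuous Lie algebra cohomology $H^p(\mathfrak g,V)$ is trivial. -/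

import Mathlib

open Set Filter Topology

set_option linter.unusedSectionVars false

namespace LCLie

/-! ## Calculus on locally convex spaces (Michal-Bastiani / Keller `C^k_c`) -/

section Calculus

/-- `f` has the directional derivative `f'` at `x` in the direction `v`:
`f' = lim_{t → 0} (f (x + t v) - f x) / t`. -/
def HasDirDeriv {E F : Type*} [AddCommGroup E] [Module ℝ E] [AddCommGroup F] [Module ℝ F]
    [TopologicalSpace F] (f : E → F) (f' : F) (x v : E) : Prop :=
  Tendsto (fun t : ℝ => t⁻¹ • (f (x + t • v) - f x)) (𝓝[≠] 0) (𝓝 f')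

/-- The directional derivative `df(x)(v)` (a junk value if the limit does not exist). -/
noncomputable def dirDeriv {E F : Type*} [AddCommGroup E] [Module ℝ E] [AddCommGroup F]
    [Module ℝ F] [TopologicalSpace F] (f : E → F) (x v : E) : F :=
  limUnder (𝓝[≠] (0 : ℝ)) (fun t : ℝ => t⁻¹ • (f (x + t • v) - f x))

/-- `f` is of class `C^n` on the open set `U`. For `n = 0` this is continuity; `f` is `C^{n+1}` if
it is continuous, all directional derivatives `df(x)(v)`, `x ∈ U`, `v ∈ E`, exist, and
`df : U × E → F` is of class `C^n`. -/
def IsCkOn {F : Type*} [AddCommGroup F] [Module ℝ F] [TopologicalSpace F] :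
    (n : ℕ) → {E : Type*} → [AddCommGroup E] → [Module ℝ E] → [TopologicalSpace E] →
      (E → F) → Set E → Prop
  | 0, _, _, _, _, f, U => ContinuousOn f U
  | n + 1, E, _, _, _, f, U => ContinuousOn f U ∧
      ∃ df : E × E → F, (∀ x ∈ U, ∀ v : E, HasDirDeriv f (df (x, v)) x v) ∧
        IsCkOn n df (U ×ˢ (univ : Set E))

/-- `f` is smooth on the open set `U`. -/
def IsSmoothOn {E F : Type*} [AddCommGroup E] [Module ℝ E] [TopologicalSpace E]
    [AddCommGroup F] [Module ℝ F] [TopologicalSpace F] (f : E → F) (U : Set E) : Prop :=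
  ∀ n : ℕ, IsCkOn n f U

/-- `γ` restricts to a smooth curve on `[0,1]` (with one-sided derivatives at the end points):
there are functions `c 0 = γ, c 1, c 2, …` such that `c (n+1)` is the derivative of `c n`
on `[0,1]`. -/
def IsSmoothCurve {V : Type*} [AddCommGroup V] [Module ℝ V] [TopologicalSpace V]
    (γ : ℝ → V) : Prop :=
  ∃ c : ℕ → ℝ → V, c 0 = γ ∧ ∀ n : ℕ, ∀ t ∈ Icc (0 : ℝ) 1,
    Tendsto (fun s : ℝ => (s - t)⁻¹ • (c n s - c n t)) (𝓝[Icc (0 : ℝ) 1 \ {t}] t)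
      (𝓝 (c (n + 1) t))

/-- `w` is the (weak) integral `∫₀¹ γ(t) dt` of the continuous curve `γ`. -/
def IsCurveIntegral {V : Type*} [AddCommGroup V] [Module ℝ V] [TopologicalSpace V]
    (γ : ℝ → V) (w : V) : Prop :=
  ∀ l : V →L[ℝ] ℝ, l w = ∫ t in (0 : ℝ)..1, l (γ t)

/-- Mackey completeness: every smooth curve `[0,1] → V` has an integral in `V`. -/
def MackeyComplete (V : Type*) [AddCommGroup V] [Module ℝ V] [TopologicalSpace V] : Prop :=
  ∀ γ : ℝ → V, IsSmoothCurve γ → ∃ w : V, IsCurveIntegral γ w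

end Calculus

/-! ## Manifolds and Lie groups modelled on locally convex spaces -/

section Manifold

/-- The product manifold `M × N`, modelled on `E × F`, with the products of charts as charts. -/
instance prodCharts {E F M N : Type*} [TopologicalSpace E] [TopologicalSpace F]
    [TopologicalSpace M] [TopologicalSpace N] [ChartedSpace E M] [ChartedSpace F N] :
    ChartedSpace (E × F) (M × N) :=
  prodChartedSpace E M F N

/-- A map between manifolds modelled on `E` and `F` is smooth if it is continuous and smooth in all
charts of the given atlases. -/
def IsSmoothMap (E F : Type*) {M N : Type*} [AddCommGroup E] [Module ℝ E] [TopologicalSpace E]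
    [AddCommGroup F] [Module ℝ F] [TopologicalSpace F] [TopologicalSpace M] [TopologicalSpace N]
    [ChartedSpace E M] [ChartedSpace F N] (f : M → N) : Prop :=
  Continuous f ∧ ∀ e ∈ atlas E M, ∀ e' ∈ atlas F N,
    IsSmoothOn (fun u : E => e' (f (e.symm u))) (e.target ∩ e.symm ⁻¹' (f ⁻¹' e'.source))

/-- A Lie group modelled on `E`: the transition maps between the charts are smooth, and so
are multiplication and inversion. -/
class LCLieGroup (E G : Type*) [AddCommGroup E] [Module ℝ E] [TopologicalSpace E]
    [TopologicalSpace G] [ChartedSpace E G] [Group G] : Prop where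
  smooth_transition : ∀ e ∈ atlas E G, ∀ e' ∈ atlas E G,
    IsSmoothOn (fun u : E => e' (e.symm u)) (e.target ∩ e.symm ⁻¹' e'.source)
  smooth_mul : IsSmoothMap (E × E) E (fun p : G × G => p.1 * p.2)
  smooth_inv : IsSmoothMap E E (fun g : G => g⁻¹)

/-- A smooth `G`-module: `G` acts on `V` by linear maps and `G × V → V` is smooth. -/
class SmoothModule (E G V : Type*) [AddCommGroup E] [Module ℝ E] [TopologicalSpace E]
    [TopologicalSpace G] [ChartedSpace E G] [Group G]
    [AddCommGroup V] [Module ℝ V] [TopologicalSpace V]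
    [DistribMulAction G V] [SMulCommClass G ℝ V] : Prop where
  smooth_smul : IsSmoothMap (E × V) V (fun p : G × V => p.1 • p.2)

end Manifold

/-! ## The Lie algebra, the adjoint action and the derived action

The tangent space `T_1 G = L(G)` is identified with the model space `E` through the preferred chart
`chartAt E 1`. -/

section LieAlgebra

/-- The Lie algebra `L(G) = T_1 G` as a locally convex space. Its bracket is `lieBracket E G`. -/
abbrev LieAlg (E G : Type*) [TopologicalSpace E] [TopologicalSpace G] [ChartedSpace E G]
    [Group G] : Type _ := E

variable (E G : Type*) [AddCommGroup E] [Module ℝ E] [TopologicalSpace E]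
  [TopologicalSpace G] [ChartedSpace E G] [Group G]

/-- The left invariant vector field `x_l(g) = d(λ_g)(1) x`, for `g` in the domain of the preferred
chart `φ` at `1`, written in this chart: the value at `u = φ(g)` is the derivative at `v = φ(1)` in
the direction `x` of `v ↦ φ(g φ⁻¹(v))`. -/
noncomputable def leftInvField (x : LieAlg E G) (u : E) : E :=
  dirDeriv (fun v : E => chartAt E (1 : G) ((chartAt E (1 : G)).symm u *
    (chartAt E (1 : G)).symm v)) (chartAt E (1 : G) 1) x

/-- The Lie bracket `[x, y] = [x_l, y_l](1)`, where in a chart the bracket of vector fields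
is `[X, Y](p) = dY(p)(X(p)) - dX(p)(Y(p))`. -/
noncomputable def lieBracket (x y : LieAlg E G) : LieAlg E G :=
  dirDeriv (leftInvField E G y) (chartAt E (1 : G) 1) (leftInvField E G x (chartAt E (1 : G) 1))
    - dirDeriv (leftInvField E G x) (chartAt E (1 : G) 1)
        (leftInvField E G y (chartAt E (1 : G) 1))

/-- The map `Ad(g) = T_1(c_g)`, where `c_g(h) = g h g⁻¹`, as a function. -/
noncomputable def AdFun (g : G) (x : LieAlg E G) : LieAlg E G :=
  dirDeriv (fun u : E => chartAt E (1 : G) (g * (chartAt E (1 : G)).symm u * g⁻¹))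
    (chartAt E (1 : G) 1) x

/-- The derived action of `L(G)` on a smooth `G`-module `V`: `x.v` is the derivative at `1` in the
direction `x` of the orbit map `g ↦ g • v`. -/
noncomputable def lieAct {V : Type*} [AddCommGroup V] [Module ℝ V] [TopologicalSpace V]
    [DistribMulAction G V] (x : LieAlg E G) (v : V) : V :=
  dirDeriv (fun u : E => (chartAt E (1 : G)).symm u • v) (chartAt E (1 : G) 1) x

end LieAlgebra

/-! ## Auxiliary facts: the derived action is linear in `V`, and `Ad(g)` is continuous linear -/

section Aux

variable {E F K : Type*} [AddCommGroup E] [Module ℝ E] [TopologicalSpace E]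
  [AddCommGroup F] [Module ℝ F] [TopologicalSpace F]

lemma HasDirDeriv.dirDeriv_eq [T2Space F] {f : E → F} {f' : F} {x v : E}
    (h : HasDirDeriv f f' x v) : dirDeriv f x v = f' :=
  Tendsto.limUnder_eq h

lemma HasDirDeriv.smul_dir [ContinuousSMul ℝ F] {f : E → F} {f' : F} {x v : E}
    (h : HasDirDeriv f f' x v) (r : ℝ) : HasDirDeriv f (r • f') x (r • v) := by
  rcases eq_or_ne r 0 with rfl | hr
  · simp only [HasDirDeriv, zero_smul, smul_zero, add_zero, sub_self]
    exact tendsto_const_nhds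
  · have h1 : Tendsto (fun t : ℝ => t * r) (𝓝[≠] 0) (𝓝[≠] 0) := by
      refine tendsto_nhdsWithin_iff.2 ⟨?_, ?_⟩
      · have : Tendsto (fun t : ℝ => t * r) (𝓝 0) (𝓝 (0 * r)) := tendsto_id.mul_const r
        rw [zero_mul] at this
        exact this.mono_left nhdsWithin_le_nhds
      · filter_upwards [self_mem_nhdsWithin] with t ht
        exact mul_ne_zero ht hr
    have h2 := (h.comp h1).const_smul r
    refine h2.congr' ?_
    filter_upwards [self_mem_nhdsWithin] with t ht
    have ht' : t ≠ 0 := ht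
    simp only [Function.comp, smul_smul]
    congr 1
    field_simp

/-- Derivative of `s ↦ l (g (z + s • w))` for a functional `l`. -/
lemma HasDirDeriv.hasDerivAt_comp {g : E → F} {g' : F} {z w : E} {s : ℝ}
    (h : HasDirDeriv g g' (z + s • w) w) (l : F →L[ℝ] ℝ) :
    HasDerivAt (fun r : ℝ => l (g (z + r • w))) (l g') s := by
  rw [hasDerivAt_iff_tendsto_slope_zero]
  refine ((l.continuous.tendsto _).comp h).congr fun t => ?_
  simp only [Function.comp, map_smul, map_sub, add_smul, add_assoc]

/-- Mean value theorem with values in a closed convex set. -/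
lemma mvt_mem [IsTopologicalAddGroup F] [ContinuousSMul ℝ F] [LocallyConvexSpace ℝ F]
    {g : E → F} {d : ℝ → F} {z w : E} {a : ℝ}
    (hd : ∀ s ∈ Icc (0 : ℝ) 1, HasDirDeriv g (d s) (z + s • (a • w)) (a • w))
    {C : Set F} (hC : Convex ℝ C) (hC' : IsClosed C)
    (hmem : ∀ s ∈ Icc (0 : ℝ) 1, a⁻¹ • d s ∈ C) :
    a⁻¹ • (g (z + a • w) - g z) ∈ C := by
  by_contra hnot
  obtain ⟨l, u, h1, h2⟩ := geometric_hahn_banach_closed_point hC hC' hnot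
  have hder : ∀ s ∈ Icc (0 : ℝ) 1,
      HasDerivAt (fun r : ℝ => l (g (z + r • (a • w)))) (l (d s)) s :=
    fun s hs => (hd s hs).hasDerivAt_comp l
  obtain ⟨s, hs, hs'⟩ := exists_hasDerivAt_eq_slope
    (fun r : ℝ => l (g (z + r • (a • w)))) (fun s => l (d s)) zero_lt_one
    (fun s hs => (hder s hs).continuousAt.continuousWithinAt)
    (fun s hs => hder s (Ioo_subset_Icc_self hs))
  have h3 := h1 _ (hmem s (Ioo_subset_Icc_self hs))
  simp only [one_smul, zero_smul, add_zero, sub_zero, div_one] at hs'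
  rw [map_smul, hs', ← map_sub, ← map_smul] at h3
  exact lt_irrefl _ (h3.trans h2)

/-- Uniform convergence of the difference quotients of a `C^1` map. -/
lemma tendsto_quotient [IsTopologicalAddGroup E] [ContinuousSMul ℝ E]
    [IsTopologicalAddGroup F] [ContinuousSMul ℝ F] [LocallyConvexSpace ℝ F] [T2Space F]
    {U : Set E} (hU : IsOpen U) {g : E → F} {dg : E × E → F}
    (hd : ∀ x ∈ U, ∀ v : E, HasDirDeriv g (dg (x, v)) x v)
    (hc : ContinuousOn dg (U ×ˢ (univ : Set E))) {y w : E} (hy : y ∈ U) :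
    Tendsto (fun p : E × ℝ × E => p.2.1⁻¹ • (g (p.1 + p.2.1 • p.2.2) - g p.1))
      (𝓝 y ×ˢ (𝓝[≠] (0 : ℝ) ×ˢ 𝓝 w)) (𝓝 (dg (y, w))) := by
  have hhom : ∀ x ∈ U, ∀ v : E, ∀ r : ℝ, dg (x, r • v) = r • dg (x, v) := fun x hx v r =>
    tendsto_nhds_unique (hd x hx (r • v)) ((hd x hx v).smul_dir r)
  have hbasis : (𝓝 (dg (y, w))).HasBasis
      (fun C : Set F => (C ∈ 𝓝 (dg (y, w)) ∧ IsClosed C) ∧ Convex ℝ C) id := by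
    refine ⟨fun t => ⟨fun ht => ?_, fun ⟨C, hC, hCt⟩ => mem_of_superset hC.1.1 hCt⟩⟩
    obtain ⟨t', ht', htc, htt⟩ := exists_mem_nhds_isClosed_subset ht
    obtain ⟨C, ⟨hC, hCc⟩, hCs⟩ := (LocallyConvexSpace.convex_basis (𝕜 := ℝ) (dg (y, w))).mem_iff.1 ht'
    exact ⟨closure C, ⟨⟨mem_of_superset hC subset_closure, isClosed_closure⟩, hCc.closure⟩,
      (closure_minimal hCs htc).trans htt⟩
  rw [hbasis.tendsto_right_iff]
  rintro C ⟨⟨hC, hCcl⟩, hCconv⟩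
  have hUn : U ×ˢ (univ : Set E) ∈ 𝓝 (y, w) := (hU.prod isOpen_univ).mem_nhds ⟨hy, mem_univ _⟩
  have hev : ∀ᶠ q : E × E in 𝓝 (y, w), q.1 ∈ U ∧ dg q ∈ C := by
    filter_upwards [(hc.continuousAt hUn) hC, hUn] with q hq1 hq2 using ⟨hq2.1, hq1⟩
  have hmap : Tendsto (fun q : E × ℝ × E => (q.1 + q.2.1 • q.2.2, q.2.2))
      (𝓝 (y, (0 : ℝ), w)) (𝓝 (y, w)) := by
    have : Continuous (fun q : E × ℝ × E => (q.1 + q.2.1 • q.2.2, q.2.2)) := by fun_prop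
    simpa using this.tendsto (y, (0 : ℝ), w)
  have hev2 := hmap.eventually hev
  rw [nhds_prod_eq, nhds_prod_eq] at hev2
  obtain ⟨A, hA, B, hB, hAB⟩ := mem_prod_iff.1 hev2
  obtain ⟨T, hT, W, hW, hTW⟩ := mem_prod_iff.1 hB
  obtain ⟨ε, hε, hεT⟩ := Metric.mem_nhds_iff.1 hT
  have hT' : Metric.ball (0 : ℝ) ε ∩ {0}ᶜ ∈ 𝓝[≠] (0 : ℝ) :=
    inter_mem (mem_nhdsWithin_of_mem_nhds (Metric.ball_mem_nhds _ hε)) self_mem_nhdsWithin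
  filter_upwards [prod_mem_prod hA (prod_mem_prod hT' hW)]
  rintro ⟨z, a, w'⟩ ⟨hz, ⟨ha, ha0⟩, hw'⟩
  have ha0' : a ≠ 0 := ha0
  have hkey : ∀ s ∈ Icc (0 : ℝ) 1,
      (z + (s * a) • w') ∈ U ∧ dg (z + (s * a) • w', w') ∈ C := by
    intro s hs
    have hsa : s * a ∈ T := hεT (by
      rw [mem_ball_zero_iff, norm_mul, Real.norm_of_nonneg hs.1]
      rw [mem_ball_zero_iff] at ha
      exact lt_of_le_of_lt (mul_le_of_le_one_left (norm_nonneg _) hs.2) ha)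
    exact hAB (show (z, (s * a, w')) ∈ A ×ˢ B from ⟨hz, hTW ⟨hsa, hw'⟩⟩)
  refine mvt_mem (d := fun s => dg (z + (s * a) • w', a • w')) ?_ hCconv hCcl ?_
  · intro s hs
    rw [smul_smul]
    exact hd _ (hkey s hs).1 _
  · intro s hs
    rw [hhom _ (hkey s hs).1, smul_smul, inv_mul_cancel₀ ha0', one_smul]
    exact (hkey s hs).2

/-- The derivative of a `C^1` map is additive in the direction. -/
lemma deriv_add [IsTopologicalAddGroup E] [ContinuousSMul ℝ E]
    [IsTopologicalAddGroup F] [ContinuousSMul ℝ F] [LocallyConvexSpace ℝ F] [T2Space F]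
    {U : Set E} (hU : IsOpen U) {g : E → F} {dg : E × E → F}
    (hd : ∀ x ∈ U, ∀ v : E, HasDirDeriv g (dg (x, v)) x v)
    (hc : ContinuousOn dg (U ×ˢ (univ : Set E))) {y : E} (hy : y ∈ U) (v w : E) :
    dg (y, v + w) = dg (y, v) + dg (y, w) := by
  have h1 : Tendsto (fun t : ℝ => (y + t • v, (t, w))) (𝓝[≠] 0)
      (𝓝 y ×ˢ (𝓝[≠] (0 : ℝ) ×ˢ 𝓝 w)) := by
    refine Tendsto.prodMk ?_ (tendsto_id.prodMk tendsto_const_nhds)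
    have : Continuous (fun t : ℝ => y + t • v) := by fun_prop
    have h := this.tendsto 0
    simp only [zero_smul, add_zero] at h
    exact h.mono_left nhdsWithin_le_nhds
  have h2 := (hd y hy v).add ((tendsto_quotient hU hd hc (w := w) hy).comp h1)
  refine tendsto_nhds_unique (hd y hy (v + w)) (h2.congr fun t => ?_)
  simp only [Function.comp, smul_add, ← add_assoc, smul_sub]
  abel

/-- Chain rule. -/
lemma HasDirDeriv.chain [AddCommGroup K] [Module ℝ K] [IsTopologicalAddGroup E]
    [ContinuousSMul ℝ E]
    [IsTopologicalAddGroup F] [ContinuousSMul ℝ F] [LocallyConvexSpace ℝ F] [T2Space F]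
    {U : Set E} (hU : IsOpen U) {g : E → F} {dg : E × E → F}
    (hd : ∀ x ∈ U, ∀ v : E, HasDirDeriv g (dg (x, v)) x v)
    (hc : ContinuousOn dg (U ×ˢ (univ : Set E))) {f : K → E} {x v : K} {w : E}
    (hx : f x ∈ U) (hf : HasDirDeriv f w x v) :
    HasDirDeriv (fun k => g (f k)) (dg (f x, w)) x v := by
  have h1 : Tendsto (fun t : ℝ => (f x, (t, t⁻¹ • (f (x + t • v) - f x)))) (𝓝[≠] 0)
      (𝓝 (f x) ×ˢ (𝓝[≠] (0 : ℝ) ×ˢ 𝓝 w)) :=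
    tendsto_const_nhds.prodMk (tendsto_id.prodMk hf)
  refine ((tendsto_quotient hU hd hc (w := w) hx).comp h1).congr' ?_
  filter_upwards [self_mem_nhdsWithin] with t ht
  have ht' : t ≠ 0 := ht
  simp [Function.comp, smul_smul, ht']

end Aux

section LinearAction

variable {E G V : Type*} [AddCommGroup E] [Module ℝ E] [TopologicalSpace E]
  [IsTopologicalAddGroup E] [ContinuousSMul ℝ E] [LocallyConvexSpace ℝ E] [T2Space E]
  [TopologicalSpace G] [ChartedSpace E G] [Group G]

/-- Left translation by `g` in charts at `h` and `k = g * h` is `C^1`. -/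
lemma translation_left [LCLieGroup E G] (g h k : G) (hk : g * h = k) :
    ∃ U : Set E, IsOpen U ∧ chartAt E h h ∈ U ∧ ∃ d : E × E → E,
      (∀ x ∈ U, ∀ v : E, HasDirDeriv
        (fun u : E => chartAt E k (g * (chartAt E h).symm u)) (d (x, v)) x v) ∧
      ContinuousOn d (U ×ˢ (univ : Set E)) := by
  obtain ⟨hcont, hsm⟩ := LCLieGroup.smooth_mul (E := E) (G := G)
  obtain ⟨-, D, hD, hDc⟩ := hsm ((chartAt E g).prod (chartAt E h))
    (chart_mem_atlas (E × E) (g, h)) (chartAt E k) (chart_mem_atlas E k) 1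
  have hWo := ((chartAt E g).prod (chartAt E h)).isOpen_inter_preimage_symm
    ((chartAt E k).open_source.preimage hcont)
  set W := ((chartAt E g).prod (chartAt E h)).target ∩ ((chartAt E g).prod (chartAt E h)).symm ⁻¹'
    ((fun p : G × G => p.1 * p.2) ⁻¹' (chartAt E k).source) with hW
  have hj : Continuous (fun u : E => (chartAt E g g, u)) := by fun_prop
  refine ⟨(fun u : E => (chartAt E g g, u)) ⁻¹' W, hWo.preimage hj, ?_,
    fun q => D ((chartAt E g g, q.1), (0, q.2)), ?_, ?_⟩
  · simp only [hW, mem_preimage, mem_inter_iff, OpenPartialHomeomorph.prod_target, mem_prod,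
      OpenPartialHomeomorph.prod_symm, OpenPartialHomeomorph.prod_apply, mem_chart_target,
      mem_chart_source, OpenPartialHomeomorph.left_inv, hk, true_and]
  · intro x hx v
    refine (hD _ hx (0, v)).congr fun t => ?_
    simp [OpenPartialHomeomorph.prod_symm, mem_chart_source]
  · refine hDc.comp (by fun_prop) ?_
    rintro ⟨a, b⟩ ⟨ha, -⟩
    exact ⟨ha, mem_univ _⟩

/-- Right translation by `g` in charts at `h` and `k = h * g` is `C^1`. -/
lemma translation_right [LCLieGroup E G] (g h k : G) (hk : h * g = k) :
    ∃ U : Set E, IsOpen U ∧ chartAt E h h ∈ U ∧ ∃ d : E × E → E,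
      (∀ x ∈ U, ∀ v : E, HasDirDeriv
        (fun u : E => chartAt E k ((chartAt E h).symm u * g)) (d (x, v)) x v) ∧
      ContinuousOn d (U ×ˢ (univ : Set E)) := by
  obtain ⟨hcont, hsm⟩ := LCLieGroup.smooth_mul (E := E) (G := G)
  obtain ⟨-, D, hD, hDc⟩ := hsm ((chartAt E h).prod (chartAt E g))
    (chart_mem_atlas (E × E) (h, g)) (chartAt E k) (chart_mem_atlas E k) 1
  have hWo := ((chartAt E h).prod (chartAt E g)).isOpen_inter_preimage_symm
    ((chartAt E k).open_source.preimage hcont)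
  set W := ((chartAt E h).prod (chartAt E g)).target ∩ ((chartAt E h).prod (chartAt E g)).symm ⁻¹'
    ((fun p : G × G => p.1 * p.2) ⁻¹' (chartAt E k).source) with hW
  have hj : Continuous (fun u : E => (u, chartAt E g g)) := by fun_prop
  refine ⟨(fun u : E => (u, chartAt E g g)) ⁻¹' W, hWo.preimage hj, ?_,
    fun q => D ((q.1, chartAt E g g), (q.2, 0)), ?_, ?_⟩
  · simp only [hW, mem_preimage, mem_inter_iff, OpenPartialHomeomorph.prod_target, mem_prod,
      OpenPartialHomeomorph.prod_symm, OpenPartialHomeomorph.prod_apply, mem_chart_target,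
      mem_chart_source, OpenPartialHomeomorph.left_inv, hk, true_and]
  · intro x hx v
    refine (hD _ hx (v, 0)).congr fun t => ?_
    simp [OpenPartialHomeomorph.prod_symm, mem_chart_source]
  · refine hDc.comp (by fun_prop) ?_
    rintro ⟨a, b⟩ ⟨ha, -⟩
    exact ⟨ha, mem_univ _⟩

lemma AdFun_isLinear [LCLieGroup E G] (g : G) :
    (∀ x y : E, AdFun E G g (x + y) = AdFun E G g x + AdFun E G g y) ∧
    (∀ (r : ℝ) (x : E), AdFun E G g (r • x) = r • AdFun E G g x) ∧
    Continuous (AdFun E G g) := by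
  obtain ⟨U₁, hU₁, h1U, d₁, hd₁, hc₁⟩ := translation_left (E := E) g 1 g (mul_one g)
  obtain ⟨U₂, hU₂, h2U, d₂, hd₂, hc₂⟩ := translation_right (E := E) g⁻¹ g 1 (mul_inv_cancel g)
  have hval : (chartAt E g) (g * (chartAt E (1 : G)).symm (chartAt E (1 : G) 1)) = chartAt E g g := by
    rw [OpenPartialHomeomorph.left_inv _ (mem_chart_source E (1 : G)), mul_one]
  have key : ∀ x : E, HasDirDeriv
      (fun u : E => chartAt E (1 : G) (g * (chartAt E (1 : G)).symm u * g⁻¹))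
      (d₂ (chartAt E g g, d₁ (chartAt E (1 : G) 1, x))) (chartAt E (1 : G) 1) x := by
    intro x
    have hch := HasDirDeriv.chain hU₂ hd₂ hc₂ (by rw [hval]; exact h2U)
      (hd₁ _ h1U x)
    rw [hval] at hch
    have hnear : ∀ᶠ u in 𝓝 (chartAt E (1 : G) 1),
        g * (chartAt E (1 : G)).symm u ∈ (chartAt E g).source := by
      have hcs : ContinuousAt (chartAt E (1 : G)).symm (chartAt E (1 : G) 1) :=
        (chartAt E (1 : G)).continuousAt_symm (mem_chart_target E (1 : G))
      have hmul : Continuous (fun h : G => g * h) :=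
        (LCLieGroup.smooth_mul (E := E) (G := G)).1.comp (by fun_prop : Continuous fun h : G => (g, h))
      have := (hmul.continuousAt.comp hcs : ContinuousAt
        (fun u => g * (chartAt E (1 : G)).symm u) (chartAt E (1 : G) 1))
      refine this.eventually ((chartAt E g).open_source.mem_nhds ?_)
      rw [Function.comp_apply]
      rw [OpenPartialHomeomorph.left_inv _ (mem_chart_source E (1 : G)), mul_one]
      exact mem_chart_source E g
    have hline : Tendsto (fun t : ℝ => chartAt E (1 : G) 1 + t • x) (𝓝[≠] 0)
        (𝓝 (chartAt E (1 : G) 1)) := by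
      have : Continuous (fun t : ℝ => chartAt E (1 : G) 1 + t • x) := by fun_prop
      have h := this.tendsto 0
      simp only [zero_smul, add_zero] at h
      exact h.mono_left nhdsWithin_le_nhds
    refine Tendsto.congr' ?_ hch
    filter_upwards [hline.eventually hnear] with t ht
    simp only [OpenPartialHomeomorph.left_inv _ ht,
      OpenPartialHomeomorph.left_inv _ hnear.self_of_nhds]
  have hAd : ∀ x : E, AdFun E G g x = d₂ (chartAt E g g, d₁ (chartAt E (1 : G) 1, x)) :=
    fun x => (key x).dirDeriv_eq
  refine ⟨fun x y => ?_, fun r x => ?_, ?_⟩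
  · rw [hAd, hAd, hAd, deriv_add hU₁ hd₁ hc₁ h1U, deriv_add hU₂ hd₂ hc₂ h2U]
  · exact ((key x).smul_dir r).dirDeriv_eq.trans (by rw [hAd])
  · have e : AdFun E G g = fun x => d₂ (chartAt E g g, d₁ (chartAt E (1 : G) 1, x)) := funext hAd
    rw [e]
    have c1 : Continuous (fun x : E => d₁ (chartAt E (1 : G) 1, x)) :=
      hc₁.comp_continuous (by fun_prop) (fun x => ⟨h1U, mem_univ _⟩)
    exact hc₂.comp_continuous (continuous_const.prodMk c1) (fun x => ⟨h2U, mem_univ _⟩)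

variable [AddCommGroup V] [Module ℝ V] [TopologicalSpace V]
  [IsTopologicalAddGroup V] [ContinuousSMul ℝ V] [LocallyConvexSpace ℝ V] [T2Space V]
  [DistribMulAction G V] [SMulCommClass G ℝ V]

lemma exists_lieAct [SmoothModule E G V] (x : E) (v : V) :
    HasDirDeriv (fun u : E => (chartAt E (1 : G)).symm u • v) (lieAct E G x v)
      (chartAt E (1 : G) 1) x := by
  obtain ⟨hcont, hsm⟩ := SmoothModule.smooth_smul (E := E) (G := G) (V := V)
  obtain ⟨-, D, hD, -⟩ := hsm ((chartAt E (1 : G)).prod (chartAt V v))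
    (chart_mem_atlas (E × V) ((1 : G), v)) (chartAt V v) (chart_mem_atlas V v) 1
  have h : HasDirDeriv (fun u : E => (chartAt E (1 : G)).symm u • v)
      (D ((chartAt E (1 : G) 1, v), (x, 0))) (chartAt E (1 : G) 1) x := by
    refine (hD (chartAt E (1 : G) 1, v) ?_ (x, 0)).congr fun t => ?_
    · simp [chartAt_self_eq]
    · simp [chartAt_self_eq]
  unfold lieAct
  rw [h.dirDeriv_eq]
  exact h

lemma lieAct_add [SmoothModule E G V] (x : E) (v w : V) :
    lieAct E G x (v + w) = lieAct E G x v + lieAct E G x w := by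
  refine HasDirDeriv.dirDeriv_eq ?_
  refine ((exists_lieAct (G := G) x v).add (exists_lieAct (G := G) x w)).congr fun t => ?_
  simp only [smul_add, smul_sub]
  abel

lemma lieAct_smul [SmoothModule E G V] (x : E) (r : ℝ) (v : V) :
    lieAct E G x (r • v) = r • lieAct E G x v := by
  refine HasDirDeriv.dirDeriv_eq ?_
  refine ((exists_lieAct (G := G) x v).const_smul r).congr fun t => ?_
  simp only [smul_comm _ r, smul_sub]

end LinearAction

/-! ## Continuous Lie algebra cohomology and the action of `G` -/

section Cohomology

variable (E G V : Type*) [AddCommGroup E] [Module ℝ E] [TopologicalSpace E]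
  [IsTopologicalAddGroup E] [ContinuousSMul ℝ E] [LocallyConvexSpace ℝ E] [T2Space E]
  [TopologicalSpace G] [ChartedSpace E G] [Group G] [LCLieGroup E G]
  [AddCommGroup V] [Module ℝ V] [TopologicalSpace V]
  [IsTopologicalAddGroup V] [ContinuousSMul ℝ V] [LocallyConvexSpace ℝ V] [T2Space V]
  [DistribMulAction G V] [SMulCommClass G ℝ V] [SmoothModule E G V]

/-- The continuous linear operator `Ad(g) : L(G) → L(G)`. -/
noncomputable def Ad (g : G) : LieAlg E G →L[ℝ] LieAlg E G where
  toFun := AdFun E G g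
  map_add' := (AdFun_isLinear g).1
  map_smul' := (AdFun_isLinear g).2.1
  cont := (AdFun_isLinear g).2.2

/-- The operator `v ↦ g • v` on the smooth module `V`. -/
def moduleOp (g : G) : V →L[ℝ] V where
  toFun v := g • v
  map_add' := smul_add g
  map_smul' r v := smul_comm g r v
  cont := (SmoothModule.smooth_smul (E := E) (G := G) (V := V)).1.comp
    (by fun_prop : Continuous fun v : V => (g, v))

/-- `C^p(L(G), V)`: the continuous alternating `p`-linear maps `L(G)^p → V`. -/
abbrev Cochain (p : ℕ) : Type _ := (LieAlg E G) [⋀^Fin p]→L[ℝ] V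

/-- The part of the Chevalley-Eilenberg differential that involves the bracket:
`∑_{a < b} (-1)^{a+b} ω([x_a, x_b], x_0, …, omit x_a, …, omit x_b, …, x_p)`.
The index pairs `a < b` are written as `a = i`, `b = i.succAbove j`. -/
noncomputable def bracketPart : (p : ℕ) → Cochain E G V p → (Fin (p + 1) → LieAlg E G) → V
  | 0, _, _ => 0
  | p + 1, ω, x => ∑ i : Fin (p + 2), ∑ j : Fin (p + 1),
      if i < i.succAbove j then
        (-1 : ℝ) ^ ((i : ℕ) + (i.succAbove j : ℕ)) •
          ω (Fin.cons (lieBracket E G (x i) (x (i.succAbove j)))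
            (fun k : Fin p => x (i.succAbove (j.succAbove k))))
      else 0

/-- The Chevalley-Eilenberg differential
`(dω)(x_0, …, x_p) = ∑_i (-1)^i x_i.ω(x_0, …, omit x_i, …, x_p)
  + ∑_{i<j} (-1)^{i+j} ω([x_i, x_j], x_0, …, omit x_i, …, omit x_j, …, x_p)`,
the values of `dω` being regarded as functions on `L(G)^{p+1}`. -/
noncomputable def ceDiff (p : ℕ) : Cochain E G V p →ₗ[ℝ] ((Fin (p + 1) → LieAlg E G) → V) where
  toFun ω x := (∑ i : Fin (p + 1), (-1 : ℝ) ^ (i : ℕ) •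
      lieAct E G (x i) (ω (fun k : Fin p => x (i.succAbove k)))) + bracketPart E G V p ω x
  map_add' ω η := by
    funext x
    have hb : bracketPart E G V p (ω + η) x = bracketPart E G V p ω x + bracketPart E G V p η x := by
      cases p with
      | zero => simp [bracketPart]
      | succ p =>
        simp only [bracketPart, ← Finset.sum_add_distrib]
        refine Finset.sum_congr rfl fun i _ => Finset.sum_congr rfl fun j _ => ?_
        split_ifs <;> simp
    simp only [hb, ContinuousAlternatingMap.add_apply, lieAct_add, smul_add,
      Finset.sum_add_distrib, Pi.add_apply]
    abel
  map_smul' r ω := by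
    funext x
    have hb : bracketPart E G V p (r • ω) x = r • bracketPart E G V p ω x := by
      cases p with
      | zero => simp [bracketPart]
      | succ p =>
        simp only [bracketPart, Finset.smul_sum]
        refine Finset.sum_congr rfl fun i _ => Finset.sum_congr rfl fun j _ => ?_
        split_ifs <;> simp [smul_comm r]
    simp only [hb, ContinuousAlternatingMap.smul_apply, lieAct_smul, smul_add, Finset.smul_sum,
      Pi.smul_apply, RingHom.id_apply, smul_comm r]

/-- The space `Z^p(L(G), V)` of continuous `p`-cocycles. -/
noncomputable def cocycles (p : ℕ) : Submodule ℝ (Cochain E G V p) :=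
  LinearMap.ker (ceDiff E G V p)

/-- The space `B^p(L(G), V)` of `p`-coboundaries: the `p`-cochains of the form `dη` with a
continuous `(p-1)`-cochain `η`; `B^0 = 0`. -/
noncomputable def coboundaries : (p : ℕ) → Submodule ℝ (Cochain E G V p)
  | 0 => ⊥
  | p + 1 =>
    { carrier := {ω | ∃ η : Cochain E G V p, ceDiff E G V p η = ⇑ω}
      zero_mem' := ⟨0, by rw [map_zero]; rfl⟩
      add_mem' := by
        rintro ω ω' ⟨η, h⟩ ⟨η', h'⟩
        exact ⟨η + η', by rw [map_add, h, h']; rfl⟩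
      smul_mem' := by
        rintro r ω ⟨η, h⟩
        exact ⟨r • η, by rw [map_smul, h]; rfl⟩ }

/-- The continuous Lie algebra cohomology `H^p(L(G), V) = Z^p(L(G), V) / B^p(L(G), V)`. -/
abbrev Cohomology (p : ℕ) : Type _ :=
  cocycles E G V p ⧸ (coboundaries E G V p).submoduleOf (cocycles E G V p)

/-- The action of `G` on cochains,
`(g.ω)(x_1, …, x_p) = g.ω(Ad(g)⁻¹ x_1, …, Ad(g)⁻¹ x_p)`, where `Ad(g)⁻¹ = Ad(g⁻¹)`. -/
noncomputable def cochainAct (p : ℕ) (g : G) : Cochain E G V p →ₗ[ℝ] Cochain E G V p where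
  toFun ω := (moduleOp E G V g).compContinuousAlternatingMap
    (ω.compContinuousLinearMap (Ad E G g⁻¹))
  map_add' ω η := by ext x; simp
  map_smul' r ω := by ext x; simp

end Cohomology

end LCLie

/-! The argument is a homotopy argument along short segments in a chart, followed by connectedness.
Write `L_x ω` for the Lie derivative of a cochain, `i_x ω` for its insertion, and `δ(u)w` for the
left logarithmic derivative. In the chart at `1`, the orbit map `u ↦ u.ω` has derivative
`u.(L_{δ(u)w} ω)` at `u` in the direction `w` (`hasDirDeriv_cochainAct`). If `ω` is a cocycle of
positive degree, Cartan's formula gives `L_x ω = d(i_x ω)` (`ceDiff_interior`). Since `d` is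
`G`-equivariant (`ceDiff_cochainAct`), the derivative of the orbit map is `d(u.(i_{δ(u)w} ω))`.

Integrating over a segment that starts at `1` gives `g.ω - ω = d I` with `I = ∫₀¹ u_t.(i_{δ(u_t)w}
ω) dt` (`cochainAct_sub_mem_of_segment`). No topology on the space of cochains is needed. The
integral is taken pointwise, and it exists because the integrand is a smooth curve in the Mackey
complete space `V`. Uniqueness of weak integrals makes `I` multilinear and alternating, and joint
continuity of the integrand makes it continuous (`exists_alternating_integral`). In degree `0` the
derivative vanishes and `g.ω = ω`.

So all `g` near `1` act trivially on cohomology. The elements acting trivially form a subgroup,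
which is then open, hence closed, hence all of the connected group `G` (`trivialSubgroup_eq_top`).

The Lie theoretic input is that `u ↦ Ad(u)⁻¹ y` has derivative `[y, x]` at `1` in the direction `x`
(`hasDirDeriv_adInv`). It rests on the symmetry of second derivatives of the multiplication. -/

namespace LCLie

/-! ### Rules for directional derivatives -/

section DirDeriv

variable {E F H : Type*} [AddCommGroup E] [Module ℝ E] [TopologicalSpace E]
  [AddCommGroup F] [Module ℝ F] [TopologicalSpace F]
  [AddCommGroup H] [Module ℝ H] [TopologicalSpace H]

lemma tendsto_line [ContinuousAdd E] [ContinuousSMul ℝ E] (x v : E) :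
    Tendsto (fun t : ℝ => x + t • v) (𝓝[≠] 0) (𝓝 x) := by
  have : Continuous (fun t : ℝ => x + t • v) := by fun_prop
  have h := this.tendsto 0
  simp only [zero_smul, add_zero] at h
  exact h.mono_left nhdsWithin_le_nhds

lemma HasDirDeriv.congr_eventually [ContinuousAdd E] [ContinuousSMul ℝ E] {f g : E → F} {f' : F}
    {x v : E} (h : HasDirDeriv f f' x v) (hfg : f =ᶠ[𝓝 x] g) : HasDirDeriv g f' x v := by
  refine Tendsto.congr' ?_ h
  filter_upwards [(tendsto_line x v).eventually hfg] with t ht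
  rw [ht, hfg.self_of_nhds]

lemma HasDirDeriv.unique [T2Space F] {f : E → F} {f' f'' : F} {x v : E}
    (h : HasDirDeriv f f' x v) (h' : HasDirDeriv f f'' x v) : f' = f'' :=
  tendsto_nhds_unique h h'

lemma HasDirDeriv.prodMk {f : E → F} {g : E → H} {f' : F} {g' : H} {x v : E}
    (hf : HasDirDeriv f f' x v) (hg : HasDirDeriv g g' x v) :
    HasDirDeriv (fun y => (f y, g y)) (f', g') x v :=
  (Tendsto.prodMk_nhds hf hg).congr fun _ => rfl

lemma HasDirDeriv.pi {ι : Type*} {f : ι → E → F} {f' : ι → F} {x v : E}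
    (hf : ∀ i, HasDirDeriv (f i) (f' i) x v) : HasDirDeriv (fun y i => f i y) f' x v :=
  (tendsto_pi_nhds.2 fun i => hf i).congr fun _ => rfl

lemma HasDirDeriv.add_fun [ContinuousAdd F] {f g : E → F} {f' g' : F} {x v : E}
    (hf : HasDirDeriv f f' x v) (hg : HasDirDeriv g g' x v) :
    HasDirDeriv (fun y => f y + g y) (f' + g') x v := by
  refine (Tendsto.add hf hg).congr fun t => ?_
  rw [← smul_add]
  beta_reduce
  congr 1
  abel

lemma HasDirDeriv.clm_comp (L : F →L[ℝ] H) {f : E → F} {f' : F} {x v : E}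
    (hf : HasDirDeriv f f' x v) : HasDirDeriv (fun y => L (f y)) (L f') x v := by
  refine ((L.continuous.tendsto _).comp hf).congr fun t => ?_
  simp

lemma hasDirDeriv_const (c : F) (x v : E) : HasDirDeriv (fun _ : E => c) 0 x v := by
  simpa [HasDirDeriv] using tendsto_const_nhds

lemma hasDirDeriv_clm [ContinuousSMul ℝ F] (L : E →L[ℝ] F) (x v : E) :
    HasDirDeriv L (L v) x v := by
  refine tendsto_const_nhds.congr' ?_
  filter_upwards [self_mem_nhdsWithin] with t ht
  have ht' : t ≠ 0 := ht
  simp [smul_smul, ht']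

/-- Precomposition with an affine map. -/
lemma HasDirDeriv.comp_affine {g : F → H} {g' : H} {L : E → F} {L' : F} {x v : E}
    (h : HasDirDeriv g g' (L x) L') (hL : ∀ t : ℝ, L (x + t • v) = L x + t • L') :
    HasDirDeriv (fun y => g (L y)) g' x v := by
  refine Tendsto.congr (fun t => ?_) h
  simp only [hL]

/-- The directional derivatives of a continuous multilinear map. -/
lemma hasDirDeriv_multilinear [IsTopologicalAddGroup E] [ContinuousSMul ℝ E]
    [IsTopologicalAddGroup F] [ContinuousSMul ℝ F] {p : ℕ}
    (ω : ContinuousMultilinearMap ℝ (fun _ : Fin p => E) F) (x v : Fin p → E) :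
    HasDirDeriv ω (∑ i, ω (Function.update x i (v i))) x v := by
  -- Telescoping: the `i`-th summand of the difference quotient has the slots before `i` already
  -- moved, the increment in slot `i`, and the slots after `i` not yet moved.
  have h1 : ∀ i : Fin p, Tendsto (fun t : ℝ => ω (fun j =>
      if j < i then x j + t • v j else if j = i then v j else x j)) (𝓝[≠] 0)
      (𝓝 (ω (Function.update x i (v i)))) := by
    intro i
    have hc : Continuous (fun t : ℝ => ω (fun j =>
        if j < i then x j + t • v j else if j = i then v j else x j)) := by
      refine ω.cont.comp (continuous_pi fun j => ?_)
      split_ifs <;> fun_prop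
    have h := (hc.tendsto 0).mono_left (nhdsWithin_le_nhds (s := {0}ᶜ))
    convert h using 3
    ext j
    by_cases hj : j = i
    · subst hj; simp
    · simp [hj]
  refine (tendsto_finsetSum Finset.univ fun i _ => h1 i).congr' ?_
  filter_upwards [self_mem_nhdsWithin] with t ht
  have ht' : t ≠ 0 := ht
  have h2 := ω.toMultilinearMap.map_piecewise_sub_map_piecewise (x + t • v) x x Finset.univ
  simp only [Finset.piecewise_univ, Finset.mem_univ, if_true] at h2
  have h3 : ω (x + t • v) - ω x = _ := h2
  rw [h3, Finset.smul_sum]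
  refine Finset.sum_congr rfl fun i _ => ?_
  have h4 : (fun j => if j < i then (x + t • v) j
      else if j = i then (x + t • v) j - x j else x j) =
      Function.update (fun j => if j < i then x j + t • v j else if j = i then v j else x j) i
        (t • v i) := by
    ext j
    by_cases hj : j = i
    · subst hj; simp
    · simp [hj]
  have h5 : (fun j => if j < i then x j + t • v j else if j = i then v j else x j) =
      Function.update (fun j => if j < i then x j + t • v j else if j = i then v j else x j) i
        (v i) := by
    ext j
    by_cases hj : j = i
    · subst hj; simp
    · simp [Function.update_of_ne hj]
  rw [h4, MultilinearMap.map_update_smul, ← h5, smul_smul, inv_mul_cancel₀ ht', one_smul]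
  rfl

end DirDeriv

/-! ### Stability properties of `C^n` and smooth maps -/

section Smooth

variable {F : Type*} [AddCommGroup F] [Module ℝ F] [TopologicalSpace F]

lemma IsCkOn.continuousOn {n : ℕ} {E : Type*} [AddCommGroup E] [Module ℝ E] [TopologicalSpace E]
    {f : E → F} {U : Set E} (h : IsCkOn n f U) : ContinuousOn f U := by
  cases n with
  | zero => exact h
  | succ n => exact h.1

lemma IsCkOn.mono {n : ℕ} : ∀ {E : Type*} [AddCommGroup E] [Module ℝ E] [TopologicalSpace E]
    {f : E → F} {U W : Set E}, IsCkOn n f U → W ⊆ U → IsCkOn n f W := by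
  induction n with
  | zero => intro E _ _ _ f U W h hW; exact ContinuousOn.mono h hW
  | succ n ih =>
    rintro E _ _ _ f U W ⟨h, df, hd, hdf⟩ hW
    exact ⟨h.mono hW, df, fun x hx v => hd x (hW hx) v, ih hdf (prod_mono hW subset_rfl)⟩

lemma IsCkOn.of_succ {n : ℕ} : ∀ {E : Type*} [AddCommGroup E] [Module ℝ E] [TopologicalSpace E]
    {f : E → F} {U : Set E}, IsCkOn (n + 1) f U → IsCkOn n f U := by
  induction n with
  | zero => intro E _ _ _ f U h; exact h.1
  | succ n ih =>
    rintro E _ _ _ f U ⟨h, df, hd, hdf⟩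
    exact ⟨h, df, hd, ih hdf⟩

lemma IsCkOn.congr {n : ℕ} : ∀ {E : Type*} [AddCommGroup E] [Module ℝ E] [TopologicalSpace E]
    [ContinuousAdd E] [ContinuousSMul ℝ E] {f g : E → F} {U : Set E}, IsOpen U → IsCkOn n f U →
    EqOn f g U → IsCkOn n g U := by
  cases n with
  | zero => intro E _ _ _ _ _ f g U _ h hfg; exact ContinuousOn.congr h hfg.symm
  | succ n =>
    rintro E _ _ _ _ _ f g U hU ⟨h, df, hd, hdf⟩ hfg
    exact ⟨h.congr hfg.symm, df, fun x hx v => (hd x hx v).congr_eventually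
      (hfg.eventuallyEq_of_mem (hU.mem_nhds hx)), hdf⟩

/-- Affine precomposition needs neither the mean value theorem nor an open domain. It is therefore
available before `IsCkOn.comp`, whose induction step uses it for `q ↦ f q.1`. -/
lemma IsCkOn.comp_affine {n : ℕ} : ∀ {D E : Type*} [AddCommGroup D] [Module ℝ D]
    [TopologicalSpace D] [AddCommGroup E] [Module ℝ E] [TopologicalSpace E] [ContinuousAdd E]
    {f : E → F} {U : Set E} (c : E) (L : D →L[ℝ] E), IsCkOn n f U →
    IsCkOn n (fun x => f (c + L x)) ((fun x => c + L x) ⁻¹' U) := by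
  induction n with
  | zero =>
    intro D E _ _ _ _ _ _ _ f U c L h
    exact ContinuousOn.comp h (by fun_prop) (fun x hx => hx)
  | succ n ih =>
    rintro D E _ _ _ _ _ _ _ f U c L ⟨h, df, hd, hdf⟩
    refine ⟨h.comp (by fun_prop) (fun x hx => hx), fun q => df (c + L q.1, L q.2), ?_, ?_⟩
    · intro x hx v
      exact (hd (c + L x) hx (L v)).comp_affine (L := fun y => c + L y)
        fun t => by simp [add_assoc]
    · have h1 := (ih (c, (0 : E)) (L.prodMap L) hdf).mono
        (W := ((fun x => c + L x) ⁻¹' U) ×ˢ univ) fun q hq => ⟨hq.1, mem_univ _⟩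
      simpa [Prod.map_def] using h1

lemma IsCkOn.prodMk {H : Type*} [AddCommGroup H] [Module ℝ H] [TopologicalSpace H] {n : ℕ} :
    ∀ {E : Type*} [AddCommGroup E] [Module ℝ E] [TopologicalSpace E]
    {f : E → F} {g : E → H} {U : Set E}, IsCkOn n f U → IsCkOn n g U →
    IsCkOn n (fun x => (f x, g x)) U := by
  induction n with
  | zero => intro E _ _ _ f g U hf hg; exact ContinuousOn.prodMk hf hg
  | succ n ih =>
    rintro E _ _ _ f g U ⟨hf, df, hdf, hdf'⟩ ⟨hg, dg, hdg, hdg'⟩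
    exact ⟨hf.prodMk hg, fun q => (df q, dg q), fun x hx v => (hdf x hx v).prodMk (hdg x hx v),
      ih hdf' hdg'⟩

lemma IsCkOn.pi {ι : Type*} {n : ℕ} :
    ∀ {E : Type*} [AddCommGroup E] [Module ℝ E] [TopologicalSpace E]
    {f : ι → E → F} {U : Set E}, (∀ i, IsCkOn n (f i) U) → IsCkOn n (fun x i => f i x) U := by
  induction n with
  | zero => intro E _ _ _ f U hf; exact continuousOn_pi.2 hf
  | succ n ih =>
    intro E _ _ _ f U hf
    choose hc df hdf hdf' using hf
    exact ⟨continuousOn_pi.2 hc, fun q i => df i q, fun x hx v => .pi fun i => hdf i x hx v,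
      ih hdf'⟩

lemma isCkOn_const {n : ℕ} : ∀ {E : Type*} [AddCommGroup E] [Module ℝ E] [TopologicalSpace E]
    (c : F) (U : Set E), IsCkOn n (fun _ : E => c) U := by
  induction n generalizing F with
  | zero => intro E _ _ _ c U; exact continuousOn_const
  | succ n ih =>
    intro E _ _ _ c U
    exact ⟨continuousOn_const, fun _ => 0, fun x _ v => hasDirDeriv_const c x v, ih 0 _⟩

lemma isCkOn_clm [ContinuousSMul ℝ F] {n : ℕ} : ∀ {E : Type*} [AddCommGroup E] [Module ℝ E]
    [TopologicalSpace E] (L : E →L[ℝ] F) (U : Set E), IsCkOn n L U := by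
  induction n with
  | zero => intro E _ _ _ L U; exact L.continuous.continuousOn
  | succ n ih =>
    intro E _ _ _ L U
    exact ⟨L.continuous.continuousOn, L.comp (ContinuousLinearMap.snd ℝ E E),
      fun x _ v => hasDirDeriv_clm L x v, ih _ _⟩

lemma IsCkOn.add [ContinuousAdd F] {n : ℕ} : ∀ {E : Type*} [AddCommGroup E] [Module ℝ E]
    [TopologicalSpace E] {f g : E → F} {U : Set E}, IsCkOn n f U → IsCkOn n g U →
    IsCkOn n (fun x => f x + g x) U := by
  induction n with
  | zero => intro E _ _ _ f g U hf hg; exact ContinuousOn.add hf hg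
  | succ n ih =>
    rintro E _ _ _ f g U ⟨hf, df, hdf, hdf'⟩ ⟨hg, dg, hdg, hdg'⟩
    exact ⟨hf.add hg, fun q => df q + dg q, fun x hx v => (hdf x hx v).add_fun (hdg x hx v),
      ih hdf' hdg'⟩

lemma IsCkOn.sum [ContinuousAdd F] {n : ℕ} {ι : Type*} (s : Finset ι) {E : Type*} [AddCommGroup E]
    [Module ℝ E] [TopologicalSpace E] {f : ι → E → F} {U : Set E}
    (h : ∀ i ∈ s, IsCkOn n (f i) U) : IsCkOn n (fun x => ∑ i ∈ s, f i x) U := by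
  classical
  induction s using Finset.induction_on with
  | empty => simpa using isCkOn_const 0 U
  | insert a s ha ih =>
    simp only [Finset.sum_insert ha]
    exact (h a (Finset.mem_insert_self a s)).add
      (ih fun i hi => h i (Finset.mem_insert_of_mem hi))

/-- Compositions of `C^n` maps are `C^n`. -/
lemma IsCkOn.comp {n : ℕ} : ∀ {D E : Type*} [AddCommGroup D] [Module ℝ D]
    [TopologicalSpace D] [IsTopologicalAddGroup D] [ContinuousSMul ℝ D]
    [AddCommGroup E] [Module ℝ E] [TopologicalSpace E]
    [IsTopologicalAddGroup E] [ContinuousSMul ℝ E]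
    [IsTopologicalAddGroup F] [ContinuousSMul ℝ F] [LocallyConvexSpace ℝ F] [T2Space F]
    {g : E → F} {f : D → E} {W : Set E} {U : Set D}, IsOpen W → IsCkOn n g W → IsCkOn n f U →
    MapsTo f U W → IsCkOn n (fun x => g (f x)) U := by
  induction n with
  | zero =>
    intro D E _ _ _ _ _ _ _ _ _ _ _ _ _ _ g f W U _ hg hf hm
    exact ContinuousOn.comp hg hf hm
  | succ n ih =>
    intro D E _ _ _ _ _ _ _ _ _ _ _ _ _ _ g f W U hW hg hf hm
    have hf0 := hf.of_succ
    obtain ⟨hgc, dg, hdg, hdg'⟩ := hg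
    obtain ⟨hfc, df, hdf, hdf'⟩ := hf
    -- The derivative is `dg` composed with `(f ∘ fst, df)`, again a composite of `C^n` maps but on
    -- product spaces. This is why the induction runs over all domains at once.
    refine ⟨hgc.comp hfc hm, fun q => dg (f q.1, df q), ?_, ?_⟩
    · intro x hx v
      exact HasDirDeriv.chain hW hdg hdg'.continuousOn (hm hx) (hdf x hx v)
    · have h1 : IsCkOn n (fun q : D × D => f q.1) (U ×ˢ univ) := by
        have := hf0.comp_affine 0 (ContinuousLinearMap.fst ℝ D D)
        simp only [zero_add, ContinuousLinearMap.coe_fst'] at this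
        exact this.mono fun q hq => hq.1
      exact ih (hW.prod isOpen_univ) hdg' (h1.prodMk hdf') fun q hq => ⟨hm hq.1, mem_univ _⟩

/-- Allowing a linear map in every slot makes the class closed under differentiation: the derivative
is a sum of maps of the same shape over `D × D`, with `fst` in all slots but one and `snd` in that
one. -/
lemma isCkOn_multilinear {E : Type*} [AddCommGroup E] [Module ℝ E] [TopologicalSpace E]
    [IsTopologicalAddGroup E] [ContinuousSMul ℝ E]
    [IsTopologicalAddGroup F] [ContinuousSMul ℝ F] {p : ℕ}
    (ω : ContinuousMultilinearMap ℝ (fun _ : Fin p => E) F) {n : ℕ} :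
    ∀ {D : Type*} [AddCommGroup D] [Module ℝ D] [TopologicalSpace D] (L : Fin p → D →L[ℝ] E),
    IsCkOn n (fun x => ω (fun i => L i x)) univ := by
  induction n with
  | zero =>
    intro D _ _ _ L
    exact (ω.cont.comp (continuous_pi fun i => (L i).continuous)).continuousOn
  | succ n ih =>
    intro D _ _ _ L
    refine ⟨(ω.cont.comp (continuous_pi fun i => (L i).continuous)).continuousOn,
      fun q => ∑ i, ω (Function.update (fun j => L j q.1) i (L i q.2)), ?_, ?_⟩
    · intro x _ v
      exact (hasDirDeriv_multilinear ω (fun i => L i x) (fun i => L i v)).comp_affine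
        (L := fun y i => L i y) fun t => by ext; simp
    · rw [univ_prod_univ]
      refine IsCkOn.sum _ fun i _ => ?_
      have := ih (fun j => if j = i then (L i).comp (ContinuousLinearMap.snd ℝ D D)
        else (L j).comp (ContinuousLinearMap.fst ℝ D D))
      convert this using 3 with q
      ext j
      by_cases hj : j = i
      · subst hj; simp
      · simp [hj]

section IsSmoothOn

variable {D E H : Type*} [AddCommGroup D] [Module ℝ D] [TopologicalSpace D]
  [IsTopologicalAddGroup D] [ContinuousSMul ℝ D]
  [AddCommGroup E] [Module ℝ E] [TopologicalSpace E]
  [IsTopologicalAddGroup E] [ContinuousSMul ℝ E]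
  [AddCommGroup H] [Module ℝ H] [TopologicalSpace H]
  [IsTopologicalAddGroup F] [ContinuousSMul ℝ F] [LocallyConvexSpace ℝ F] [T2Space F]

lemma IsSmoothOn.continuousOn {f : E → F} {U : Set E} (h : IsSmoothOn f U) : ContinuousOn f U :=
  h 0

lemma IsSmoothOn.mono {f : E → F} {U W : Set E} (h : IsSmoothOn f U) (hW : W ⊆ U) :
    IsSmoothOn f W := fun n => (h n).mono hW

lemma IsSmoothOn.congr {f g : E → F} {U : Set E} (h : IsSmoothOn f U) (hU : IsOpen U)
    (hfg : EqOn f g U) : IsSmoothOn g U := fun n => (h n).congr hU hfg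

lemma IsSmoothOn.prodMk {f : E → F} {g : E → H} {U : Set E} (hf : IsSmoothOn f U)
    (hg : IsSmoothOn g U) : IsSmoothOn (fun x => (f x, g x)) U := fun n => (hf n).prodMk (hg n)

lemma IsSmoothOn.pi {ι : Type*} {f : ι → E → F} {U : Set E} (hf : ∀ i, IsSmoothOn (f i) U) :
    IsSmoothOn (fun x i => f i x) U := fun n => IsCkOn.pi fun i => hf i n

lemma IsSmoothOn.comp {g : E → F} {f : D → E} {W : Set E} {U : Set D} (hg : IsSmoothOn g W)
    (hW : IsOpen W) (hf : IsSmoothOn f U) (hm : MapsTo f U W) :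
    IsSmoothOn (fun x => g (f x)) U := fun n => IsCkOn.comp hW (hg n) (hf n) hm

lemma isSmoothOn_const (c : F) (U : Set E) : IsSmoothOn (fun _ : E => c) U :=
  fun _ => isCkOn_const c U

lemma isSmoothOn_clm (L : E →L[ℝ] F) (U : Set E) : IsSmoothOn L U := fun _ => isCkOn_clm L U

lemma isSmoothOn_id (U : Set F) : IsSmoothOn (fun x : F => x) U :=
  isSmoothOn_clm (ContinuousLinearMap.id ℝ F) U

lemma isSmoothOn_fst (U : Set (F × H)) : IsSmoothOn (fun q : F × H => q.1) U :=
  fun _ => isCkOn_clm (ContinuousLinearMap.fst ℝ F H) U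

lemma isSmoothOn_snd (U : Set (H × F)) : IsSmoothOn (fun q : H × F => q.2) U :=
  fun _ => isCkOn_clm (ContinuousLinearMap.snd ℝ H F) U

lemma isSmoothOn_multilinear {p : ℕ} (ω : ContinuousMultilinearMap ℝ (fun _ : Fin p => E) F) :
    IsSmoothOn ω univ := fun _ => isCkOn_multilinear ω fun i => ContinuousLinearMap.proj i

lemma isSmoothOn_add_smul (z w : F) (U : Set ℝ) : IsSmoothOn (fun t : ℝ => z + t • w) U :=
  fun _ => (isCkOn_const z U).add
    (isCkOn_clm (ContinuousLinearMap.smulRight (ContinuousLinearMap.id ℝ ℝ) w) U)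

lemma IsSmoothOn.hasDirDeriv {f : E → F} {U : Set E} (h : IsSmoothOn f U) {x : E} (hx : x ∈ U)
    (v : E) : HasDirDeriv f (dirDeriv f x v) x v := by
  obtain ⟨-, df, hd, -⟩ := h 1
  rw [(hd x hx v).dirDeriv_eq]
  exact hd x hx v

/-- The derivative supplied by `IsCkOn` may depend on `n`. As `F` is Hausdorff, each of these agrees
with the one function `dirDeriv` on `U`, so that function is smooth. -/
lemma IsSmoothOn.dirDeriv {f : E → F} {U : Set E} (h : IsSmoothOn f U) (hU : IsOpen U) :
    IsSmoothOn (fun q : E × E => dirDeriv f q.1 q.2) (U ×ˢ univ) := by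
  intro n
  obtain ⟨-, df, hd, hdf⟩ := h (n + 1)
  exact hdf.congr (hU.prod isOpen_univ) fun q hq => ((hd q.1 hq.1 q.2).dirDeriv_eq).symm

lemma IsSmoothOn.chain {K : Type*} [AddCommGroup K] [Module ℝ K] {g : E → F} {U : Set E}
    (hg : IsSmoothOn g U) (hU : IsOpen U) {f : K → E} {x v : K} {w : E} (hx : f x ∈ U)
    (hf : HasDirDeriv f w x v) :
    HasDirDeriv (fun k => g (f k)) (LCLie.dirDeriv g (f x) w) x v :=
  HasDirDeriv.chain hU (dg := fun q => LCLie.dirDeriv g q.1 q.2)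
    (fun _ hx v => hg.hasDirDeriv hx v) (hg.dirDeriv hU).continuousOn hx hf

lemma IsSmoothOn.dirDeriv_add {f : E → F} {U : Set E} (h : IsSmoothOn f U) (hU : IsOpen U)
    {x : E} (hx : x ∈ U) (v w : E) :
    LCLie.dirDeriv f x (v + w) = LCLie.dirDeriv f x v + LCLie.dirDeriv f x w :=
  deriv_add hU (dg := fun q => LCLie.dirDeriv f q.1 q.2)
    (fun _ hx v => h.hasDirDeriv hx v) (h.dirDeriv hU).continuousOn hx v w

lemma IsSmoothOn.deriv_curve {γ : ℝ → F} {U : Set ℝ} (h : IsSmoothOn γ U) (hU : IsOpen U) :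
    IsSmoothOn (fun t => LCLie.dirDeriv γ t 1) U :=
  IsSmoothOn.comp (g := fun q : ℝ × ℝ => LCLie.dirDeriv γ q.1 q.2) (f := fun t : ℝ => (t, (1 : ℝ)))
    (h.dirDeriv hU) (hU.prod isOpen_univ)
    ((isSmoothOn_id U).prodMk (isSmoothOn_const (1 : ℝ) U)) fun _ ht => ⟨ht, mem_univ _⟩

/-- A smooth map on an open neighbourhood of `[0,1]` restricts to a smooth curve. -/
lemma IsSmoothOn.isSmoothCurve {γ : ℝ → F} {U : Set ℝ} (h : IsSmoothOn γ U) (hU : IsOpen U)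
    (hI : Icc (0 : ℝ) 1 ⊆ U) : IsSmoothCurve γ := by
  obtain ⟨c, hc0, hc⟩ : ∃ c : ℕ → ℝ → F, c 0 = γ ∧
      ∀ n, c (n + 1) = fun t => LCLie.dirDeriv (c n) t 1 :=
    ⟨fun n => Nat.rec γ (fun _ (f : ℝ → F) t => LCLie.dirDeriv f t 1) n, rfl, fun _ => rfl⟩
  have hs : ∀ n : ℕ, IsSmoothOn (c n) U := by
    intro n
    induction n with
    | zero => rw [hc0]; exact h
    | succ n ih => rw [hc]; exact ih.deriv_curve hU
  refine ⟨c, hc0, fun n t ht => ?_⟩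
  have h1 := (hs n).hasDirDeriv (hI ht) 1
  rw [hc]
  -- Substituting the increment `s - t` into the two-sided quotient in the direction `1` gives the
  -- quotient relative to `[0,1]`.
  have h2 : Tendsto (fun s : ℝ => s - t) (𝓝[Icc (0 : ℝ) 1 \ {t}] t) (𝓝[≠] 0) := by
    refine tendsto_nhdsWithin_iff.2 ⟨?_, ?_⟩
    · have : Continuous (fun s : ℝ => s - t) := by fun_prop
      have h3 := this.tendsto t
      rw [sub_self] at h3
      exact h3.mono_left nhdsWithin_le_nhds
    · filter_upwards [self_mem_nhdsWithin] with s hs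
      exact sub_ne_zero.2 hs.2
  refine (h1.comp h2).congr fun s => ?_
  simp

end IsSmoothOn

end Smooth

/-! ### Symmetry of second derivatives -/

section Schwarz

variable {E F : Type*} [AddCommGroup E] [Module ℝ E] [TopologicalSpace E]
  [IsTopologicalAddGroup E] [ContinuousSMul ℝ E]
  [AddCommGroup F] [Module ℝ F] [TopologicalSpace F]
  [IsTopologicalAddGroup F] [ContinuousSMul ℝ F] [LocallyConvexSpace ℝ F] [T2Space F]

/-- Hahn–Banach. It reduces vector-valued identities to real ones and makes weak integrals unique.
-/
lemma eq_of_forall_clm_eq {x y : F} (h : ∀ l : F →L[ℝ] ℝ, l x = l y) : x = y := by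
  by_contra hne
  obtain ⟨l, hl⟩ := geometric_hahn_banach_point_point hne
  exact hl.ne (h l)

/-- Second order mean value theorem. -/
lemma exists_second_difference {f a c : E → ℝ} {x v w : E} {h : ℝ} (hh : 0 < h)
    (hf : ∀ s ∈ Icc 0 h, ∀ t ∈ Icc 0 h, HasDirDeriv f (a (x + s • v + t • w)) (x + s • v + t • w) v)
    (ha : ∀ s ∈ Icc 0 h, ∀ t ∈ Icc 0 h, HasDirDeriv a (c (x + s • v + t • w)) (x + s • v + t • w) w) :
    ∃ s ∈ Icc 0 h, ∃ t ∈ Icc 0 h,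
      f (x + h • v + h • w) - f (x + h • v) - f (x + h • w) + f x =
        h * h * c (x + s • v + t • w) := by
  have key : ∀ s ∈ Icc 0 h, ∀ t ∈ Icc 0 h,
      HasDerivAt (fun r : ℝ => f (x + r • v + t • w)) (a (x + s • v + t • w)) s := by
    intro s hs t ht
    have h1 := hf s hs t ht
    have e : ∀ r : ℝ, x + r • v + t • w = (x + t • w) + r • v := fun r => by abel
    simp only [e] at h1 ⊢
    exact h1.hasDerivAt_comp (ContinuousLinearMap.id ℝ ℝ)
  have h0 : (0 : ℝ) ∈ Icc 0 h := ⟨le_rfl, hh.le⟩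
  have hh' : h ∈ Icc 0 h := ⟨hh.le, le_rfl⟩
  -- The second difference is the increment over `[0, h]` of this function of `r`. The mean value
  -- theorem applied to it, and then to the resulting increment of `a` along `w`, produces `c`.
  have key1 : ∀ s ∈ Icc 0 h, HasDerivAt
      (fun r : ℝ => f (x + r • v + h • w) - f (x + r • v + (0 : ℝ) • w))
      (a (x + s • v + h • w) - a (x + s • v + (0 : ℝ) • w)) s :=
    fun s hs => (key s hs h hh').sub (key s hs 0 h0)
  obtain ⟨s, hs, hs'⟩ := exists_hasDerivAt_eq_slope _ _ hh
    (fun s hs => (key1 s hs).continuousAt.continuousWithinAt)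
    (fun s hs => key1 s (Ioo_subset_Icc_self hs))
  have hsI := Ioo_subset_Icc_self hs
  have key2 : ∀ t ∈ Icc 0 h, HasDerivAt
      (fun r : ℝ => a (x + s • v + r • w)) (c (x + s • v + t • w)) t :=
    fun t ht => (ha s hsI t ht).hasDerivAt_comp (ContinuousLinearMap.id ℝ ℝ)
  obtain ⟨t, ht, ht'⟩ := exists_hasDerivAt_eq_slope _ _ hh
    (fun s hs => (key2 s hs).continuousAt.continuousWithinAt)
    (fun s hs => key2 s (Ioo_subset_Icc_self hs))
  refine ⟨s, hsI, t, Ioo_subset_Icc_self ht, ?_⟩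
  rw [ht', hs']
  simp only [zero_smul, add_zero, sub_zero]
  field_simp
  ring

/-- Symmetry of the second derivative. -/
lemma IsSmoothOn.dirDeriv_comm {f : E → F} {U : Set E} (h : IsSmoothOn f U) (hU : IsOpen U)
    {x : E} (hx : x ∈ U) (v w : E) :
    LCLie.dirDeriv (fun y => LCLie.dirDeriv f y v) x w =
      LCLie.dirDeriv (fun y => LCLie.dirDeriv f y w) x v := by
  have hsm : ∀ v : E, IsSmoothOn (fun y => LCLie.dirDeriv f y v) U := fun v =>
    IsSmoothOn.comp (g := fun q : E × E => LCLie.dirDeriv f q.1 q.2) (f := fun y => (y, v))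
      (h.dirDeriv hU) (hU.prod isOpen_univ)
      (fun n => (isCkOn_clm (ContinuousLinearMap.id ℝ E) U).prodMk (isCkOn_const v U))
      fun y hy => ⟨hy, mem_univ _⟩
  have hc : ∀ v w : E,
      ContinuousOn (fun y => LCLie.dirDeriv (fun y => LCLie.dirDeriv f y v) y w) U := fun v w =>
    ((hsm v).dirDeriv hU).continuousOn.comp (f := fun y => (y, w)) (by fun_prop)
      fun y hy => ⟨hy, mem_univ _⟩
  refine eq_of_forall_clm_eq fun l => ?_
  by_contra hne
  have hcv : ∀ v w : E, ContinuousAt (fun y => l (LCLie.dirDeriv (fun y => LCLie.dirDeriv f y v) y w)) x :=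
    fun v w => l.continuous.continuousAt.comp ((hc v w).continuousAt (hU.mem_nhds hx))
  -- If the two mixed derivatives differ at `x`, then by continuity their values near `x` lie in
  -- disjoint sets `A` and `B`. The second difference is symmetric in `v` and `w`, and it forces a
  -- value in `A` to equal a value in `B`.
  obtain ⟨A, B, hA, hB, hxA, hxB, hAB⟩ := t2_separation hne
  have hev : ∀ᶠ y in 𝓝 x, y ∈ U ∧
      l (LCLie.dirDeriv (fun y => LCLie.dirDeriv f y v) y w) ∈ A ∧
      l (LCLie.dirDeriv (fun y => LCLie.dirDeriv f y w) y v) ∈ B :=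
    Filter.Eventually.and (hU.mem_nhds hx) (((hcv v w).eventually (hA.mem_nhds hxA)).and
      ((hcv w v).eventually (hB.mem_nhds hxB)))
  have hpl : Tendsto (fun q : ℝ × ℝ => x + q.1 • v + q.2 • w) (𝓝 (0, 0)) (𝓝 x) := by
    have : Continuous (fun q : ℝ × ℝ => x + q.1 • v + q.2 • w) := by fun_prop
    simpa using this.tendsto (0, 0)
  obtain ⟨ε, hε, hball⟩ := Metric.eventually_nhds_iff_ball.1 (hpl.eventually hev)
  have hin : ∀ s ∈ Icc 0 (ε / 2), ∀ t ∈ Icc 0 (ε / 2), (s, t) ∈ Metric.ball ((0 : ℝ), (0 : ℝ)) ε := by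
    intro s hs t ht
    rw [Metric.mem_ball, Prod.dist_eq, max_lt_iff, Real.dist_0_eq_abs, Real.dist_0_eq_abs,
      abs_of_nonneg hs.1, abs_of_nonneg ht.1]
    exact ⟨by linarith [hs.2], by linarith [ht.2]⟩
  obtain ⟨s, hs, t, ht, h1⟩ := exists_second_difference (f := fun y => l (f y))
    (a := fun y => l (LCLie.dirDeriv f y v))
    (c := fun y => l (LCLie.dirDeriv (fun y => LCLie.dirDeriv f y v) y w)) (x := x) (v := v)
    (w := w) (half_pos hε)
    (fun s hs t ht => (h.hasDirDeriv (hball _ (hin s hs t ht)).1 v).clm_comp l)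
    (fun s hs' t ht => ((hsm v).hasDirDeriv (hball _ (hin s hs' t ht)).1 w).clm_comp l)
  obtain ⟨t', ht', s', hs', h2⟩ := exists_second_difference (f := fun y => l (f y))
    (a := fun y => l (LCLie.dirDeriv f y w))
    (c := fun y => l (LCLie.dirDeriv (fun y => LCLie.dirDeriv f y w) y v)) (x := x) (v := w)
    (w := v) (half_pos hε)
    (fun s hs t ht => by
      rw [add_right_comm]; exact (h.hasDirDeriv (hball _ (hin t ht s hs)).1 w).clm_comp l)
    (fun s hs' t ht => by
      rw [add_right_comm]; exact ((hsm w).hasDirDeriv (hball _ (hin t ht s hs')).1 v).clm_comp l)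
  rw [add_right_comm x _ ((ε / 2) • v), add_right_comm x (t' • w)] at h2
  have h3 : ε / 2 * (ε / 2) * l (LCLie.dirDeriv (fun y => LCLie.dirDeriv f y v)
        (x + s • v + t • w) w) = ε / 2 * (ε / 2) * l (LCLie.dirDeriv
        (fun y => LCLie.dirDeriv f y w) (x + s' • v + t' • w) v) := by
    rw [← h1, ← h2]; ring
  have h4 := mul_left_cancel₀ (by positivity) h3
  have h5 := (hball _ (hin s hs t ht)).2.1
  have h6 := (hball _ (hin s' hs' t' ht')).2.2
  rw [h4] at h5
  exact disjoint_left.1 hAB h5 h6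

end Schwarz

/-! ### Weak integrals of curves and of cochains -/

section Integral

variable {V : Type*} [AddCommGroup V] [Module ℝ V] [TopologicalSpace V]

lemma intervalIntegrable_clm {γ : ℝ → V} (h : ContinuousOn γ (Icc 0 1)) (l : V →L[ℝ] ℝ) :
    IntervalIntegrable (fun t => l (γ t)) MeasureTheory.volume 0 1 :=
  ContinuousOn.intervalIntegrable (by
    rw [uIcc_of_le zero_le_one]; exact l.continuous.comp_continuousOn h)

lemma IsCurveIntegral.add [ContinuousAdd V] {γ γ' : ℝ → V} {w w' : V}
    (hγ : ContinuousOn γ (Icc 0 1)) (hγ' : ContinuousOn γ' (Icc 0 1))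
    (h : IsCurveIntegral γ w) (h' : IsCurveIntegral γ' w') :
    IsCurveIntegral (fun t => γ t + γ' t) (w + w') := by
  intro l
  simp only [map_add]
  rw [intervalIntegral.integral_add (intervalIntegrable_clm hγ l) (intervalIntegrable_clm hγ' l),
    h l, h' l]

lemma IsCurveIntegral.clm_comp {W : Type*} [AddCommGroup W] [Module ℝ W] [TopologicalSpace W]
    {γ : ℝ → V} {w : V} (h : IsCurveIntegral γ w) (L : V →L[ℝ] W) :
    IsCurveIntegral (fun t => L (γ t)) (L w) := fun l => h (l.comp L)

lemma IsCurveIntegral.const_smul {γ : ℝ → V} {w : V} (h : IsCurveIntegral γ w) (r : ℝ) :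
    IsCurveIntegral (fun t => r • γ t) (r • w) := by
  intro l
  simp only [map_smul, smul_eq_mul, intervalIntegral.integral_const_mul, h l]

lemma isCurveIntegral_zero : IsCurveIntegral (fun _ : ℝ => (0 : V)) 0 := by
  intro l
  simp

lemma IsCurveIntegral.sum [ContinuousAdd V] {ι : Type*} (s : Finset ι) {γ : ι → ℝ → V} {w : ι → V}
    (hγ : ∀ i ∈ s, ContinuousOn (γ i) (Icc 0 1)) (h : ∀ i ∈ s, IsCurveIntegral (γ i) (w i)) :
    IsCurveIntegral (fun t => ∑ i ∈ s, γ i t) (∑ i ∈ s, w i) := by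
  classical
  induction s using Finset.induction_on with
  | empty => simpa using isCurveIntegral_zero
  | insert a s ha ih =>
    simp only [Finset.sum_insert ha]
    have hs : ∀ i ∈ s, i ∈ insert a s := fun i hi => Finset.mem_insert_of_mem hi
    exact (h a (Finset.mem_insert_self a s)).add (hγ a (Finset.mem_insert_self a s))
      (continuousOn_finsetSum s fun i hi => hγ i (hs i hi))
      (ih (fun i hi => hγ i (hs i hi)) fun i hi => h i (hs i hi))

variable [IsTopologicalAddGroup V] [ContinuousSMul ℝ V] [LocallyConvexSpace ℝ V]

lemma IsCurveIntegral.unique [T2Space V] {γ : ℝ → V} {w w' : V} (h : IsCurveIntegral γ w)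
    (h' : IsCurveIntegral γ w') : w = w' :=
  eq_of_forall_clm_eq fun l => (h l).trans (h' l).symm

/-- A functional strictly separating `w` from `C` would contradict monotonicity of the real
integral. This replaces the seminorm estimate for integrals. -/
lemma IsCurveIntegral.mem {γ : ℝ → V} {w : V} (h : IsCurveIntegral γ w)
    (hγ : ContinuousOn γ (Icc 0 1)) {C : Set V} (hC : Convex ℝ C) (hC' : IsClosed C)
    (hm : ∀ t ∈ Icc (0 : ℝ) 1, γ t ∈ C) : w ∈ C := by
  by_contra hnot
  obtain ⟨l, u, h1, h2⟩ := geometric_hahn_banach_closed_point hC hC' hnot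
  have h3 : ∫ t in (0 : ℝ)..1, l (γ t) ≤ ∫ _ in (0 : ℝ)..1, u :=
    intervalIntegral.integral_mono_on zero_le_one (intervalIntegrable_clm hγ l)
      intervalIntegrable_const fun t ht => (h1 _ (hm t ht)).le
  rw [← h l] at h3
  simp only [intervalIntegral.integral_const, sub_zero, one_smul] at h3
  exact absurd h2 (not_lt.2 h3)

/-- Weak parameter integrals are continuous in the parameter. -/
lemma continuous_integral {X : Type*} [TopologicalSpace X] {f : ℝ → X → V} {I : X → V}
    (hf : ContinuousOn (fun q : ℝ × X => f q.1 q.2) (Icc 0 1 ×ˢ univ))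
    (hI : ∀ x, IsCurveIntegral (fun t => f t x) (I x)) : Continuous I := by
  have hft : ∀ x, ContinuousOn (fun t => f t x) (Icc 0 1) := fun x =>
    hf.comp (f := fun t => (t, x)) (by fun_prop) fun t ht => ⟨ht, mem_univ _⟩
  refine continuous_iff_continuousAt.2 fun x₀ => ?_
  rw [ContinuousAt, ← tendsto_sub_nhds_zero_iff]
  intro N hN
  obtain ⟨N', hN', hcl, hNN⟩ := exists_mem_nhds_isClosed_subset hN
  obtain ⟨C, ⟨hC, hCc⟩, hCs⟩ :=
    (LocallyConvexSpace.convex_basis (𝕜 := ℝ) (0 : V)).mem_iff.1 hN'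
  -- Compactness of `[0,1]` makes the estimate uniform in `t`. The repeated membership stays inside
  -- the predicate because the compactness lemma uses full neighbourhoods of `t` in `ℝ`, while `f`
  -- is controlled only over `[0,1]`.
  have hK : ∀ᶠ x in 𝓝 x₀, ∀ t ∈ Icc (0 : ℝ) 1, t ∈ Icc (0 : ℝ) 1 → f t x - f t x₀ ∈ C := by
    refine isCompact_Icc.eventually_forall_of_forall_eventually fun t ht => ?_
    have h1 : ContinuousOn (fun q : X × ℝ => f q.2 q.1 - f q.2 x₀) (univ ×ˢ Icc 0 1) :=
      (hf.comp (f := fun q : X × ℝ => (q.2, q.1)) (by fun_prop) fun q hq => ⟨hq.2, hq.1⟩).sub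
        ((hft x₀).comp (by fun_prop) fun q hq => hq.2)
    have h2 := h1 (x₀, t) ⟨mem_univ _, ht⟩
    have h3 : Tendsto (fun q : X × ℝ => f q.2 q.1 - f q.2 x₀) (𝓝[univ ×ˢ Icc 0 1] (x₀, t)) (𝓝 0) := by
      simpa [ContinuousWithinAt] using h2
    have h4 := eventually_nhdsWithin_iff.1 (h3 hC)
    filter_upwards [h4] with q hq hq'
    exact hq ⟨mem_univ _, hq'⟩
  change ∀ᶠ x in 𝓝 x₀, I x - I x₀ ∈ N
  filter_upwards [hK] with x hx
  refine hNN (closure_minimal hCs hcl ?_)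
  have hsub : IsCurveIntegral (fun t => f t x - f t x₀) (I x - I x₀) := by
    have := (hI x).add (hft x) ((hft x₀).const_smul (-1 : ℝ)) ((hI x₀).const_smul (-1))
    simpa [sub_eq_add_neg] using this
  exact hsub.mem ((hft x).sub (hft x₀)) hCc.closure isClosed_closure
    fun t ht => subset_closure (hx t ht ht)

/-- The integral of a continuous family of continuous alternating maps. -/
lemma exists_alternating_integral [T2Space V] {E : Type*} [AddCommGroup E] [Module ℝ E]
    [TopologicalSpace E] {p : ℕ} (η : ℝ → E [⋀^Fin p]→L[ℝ] V)
    (hc : ContinuousOn (fun q : ℝ × (Fin p → E) => η q.1 q.2) (Icc 0 1 ×ˢ univ))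
    (hI : ∀ y, ∃ w, IsCurveIntegral (fun t => η t y) w) :
    ∃ I : E [⋀^Fin p]→L[ℝ] V, ∀ y, IsCurveIntegral (fun t => η t y) (I y) := by
  choose I hI using hI
  have hft : ∀ y, ContinuousOn (fun t => η t y) (Icc 0 1) := fun x =>
    hc.comp (f := fun t => (t, x)) (by fun_prop) fun t ht => ⟨ht, mem_univ _⟩
  refine ⟨{ toFun := I
            map_update_add' := ?_
            map_update_smul' := ?_
            cont := ?_
            map_eq_zero_of_eq' := ?_ }, hI⟩
  · intro _ y i a b
    refine (hI _).unique ?_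
    convert (hI _).add (hft _) (hft _) (hI _) using 2 with t
    exact (η t).map_update_add' y i a b
  · intro _ y i r a
    refine (hI _).unique ?_
    convert (hI _).const_smul r using 2 with t
    exact (η t).map_update_smul' y i r a
  · exact continuous_integral hc hI
  · intro y i j hij hne
    refine (hI _).unique ?_
    convert isCurveIntegral_zero (V := V) using 2 with t
    exact (η t).map_eq_zero_of_eq y hij hne

end Integral

/-! ### The Lie group in the chart at `1` -/

section Group

variable {E G V : Type*} [AddCommGroup E] [Module ℝ E] [TopologicalSpace E]
  [IsTopologicalAddGroup E] [ContinuousSMul ℝ E] [LocallyConvexSpace ℝ E] [T2Space E]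
  [TopologicalSpace G] [ChartedSpace E G] [Group G]

lemma isTopologicalGroup (E : Type*) {G : Type*} [AddCommGroup E] [Module ℝ E]
    [TopologicalSpace E] [TopologicalSpace G] [ChartedSpace E G] [Group G] [LCLieGroup E G] :
    IsTopologicalGroup G where
  continuous_mul := (LCLieGroup.smooth_mul (E := E) (G := G)).1
  continuous_inv := (LCLieGroup.smooth_inv (E := E) (G := G)).1

/-- Multiplication in the charts at `a`, `b` and `c`. -/
lemma smooth_mul_chart [LCLieGroup E G] (a b c : G) :
    IsOpen {q : E × E | q.1 ∈ (chartAt E a).target ∧ q.2 ∈ (chartAt E b).target ∧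
      (chartAt E a).symm q.1 * (chartAt E b).symm q.2 ∈ (chartAt E c).source} ∧
    IsSmoothOn (fun q : E × E => chartAt E c ((chartAt E a).symm q.1 * (chartAt E b).symm q.2))
      {q : E × E | q.1 ∈ (chartAt E a).target ∧ q.2 ∈ (chartAt E b).target ∧
        (chartAt E a).symm q.1 * (chartAt E b).symm q.2 ∈ (chartAt E c).source} := by
  obtain ⟨hcont, hsm⟩ := LCLieGroup.smooth_mul (E := E) (G := G)
  have h := hsm ((chartAt E a).prod (chartAt E b))
    (chart_mem_atlas (E × E) (a, b)) (chartAt E c) (chart_mem_atlas E c)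
  have hWo := ((chartAt E a).prod (chartAt E b)).isOpen_inter_preimage_symm
    ((chartAt E c).open_source.preimage hcont)
  have hset : ((chartAt E a).prod (chartAt E b)).target ∩ ((chartAt E a).prod (chartAt E b)).symm ⁻¹'
      ((fun p : G × G => p.1 * p.2) ⁻¹' (chartAt E c).source) =
      {q : E × E | q.1 ∈ (chartAt E a).target ∧ q.2 ∈ (chartAt E b).target ∧
        (chartAt E a).symm q.1 * (chartAt E b).symm q.2 ∈ (chartAt E c).source} := by
    ext q
    simp [and_assoc, OpenPartialHomeomorph.prod_symm]
  rw [hset] at h hWo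
  exact ⟨hWo, h⟩

lemma one_chart_mem : chartAt E (1 : G) 1 ∈ (chartAt E (1 : G)).target := mem_chart_target E 1

@[simp] lemma chart_symm_one : (chartAt E (1 : G)).symm (chartAt E (1 : G) 1) = 1 :=
  (chartAt E (1 : G)).left_inv (mem_chart_source E 1)

variable (E G) in
/-- The domain of the multiplication in the chart at `1`. -/
def mulDom : Set (E × E) :=
  {q : E × E | q.1 ∈ (chartAt E (1 : G)).target ∧ q.2 ∈ (chartAt E (1 : G)).target ∧
    (chartAt E (1 : G)).symm q.1 * (chartAt E (1 : G)).symm q.2 ∈ (chartAt E (1 : G)).source}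

variable (E G) in
/-- The multiplication in the chart at `1`. -/
def mulChart (q : E × E) : E :=
  chartAt E (1 : G) ((chartAt E (1 : G)).symm q.1 * (chartAt E (1 : G)).symm q.2)

variable (E G) in
/-- The domain of the inversion in the chart at `1`. -/
def invDom : Set E :=
  {u : E | u ∈ (chartAt E (1 : G)).target ∧
    ((chartAt E (1 : G)).symm u)⁻¹ ∈ (chartAt E (1 : G)).source}

variable (E G) in
/-- The inversion in the chart at `1`. -/
def invChart (u : E) : E := chartAt E (1 : G) ((chartAt E (1 : G)).symm u)⁻¹

variable (E G) in
/-- The map `(u, v) ↦ u⁻¹ v` in the chart at `1`. -/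
def divChart (q : E × E) : E :=
  chartAt E (1 : G) (((chartAt E (1 : G)).symm q.1)⁻¹ * (chartAt E (1 : G)).symm q.2)

variable (E G) in
/-- The domain of `divChart`. -/
def divDom : Set (E × E) :=
  {q : E × E | q.1 ∈ invDom E G ∧ q.2 ∈ (chartAt E (1 : G)).target ∧
    ((chartAt E (1 : G)).symm q.1)⁻¹ * (chartAt E (1 : G)).symm q.2 ∈ (chartAt E (1 : G)).source}

variable (E G) in
/-- The map `(u, v) ↦ u⁻¹ v u` in the chart at `1`. -/
def conjChart (q : E × E) : E :=
  chartAt E (1 : G) (((chartAt E (1 : G)).symm q.1)⁻¹ *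
    (chartAt E (1 : G)).symm q.2 * (chartAt E (1 : G)).symm q.1)

variable (E G) in
/-- The domain of `conjChart`. -/
def conjDom : Set (E × E) :=
  {q : E × E | q ∈ divDom E G ∧ ((chartAt E (1 : G)).symm q.1)⁻¹ *
    (chartAt E (1 : G)).symm q.2 * (chartAt E (1 : G)).symm q.1 ∈ (chartAt E (1 : G)).source}

variable [LCLieGroup E G]

lemma isOpen_mulDom : IsOpen (mulDom E G) := (smooth_mul_chart 1 1 1).1

lemma smooth_mulChart : IsSmoothOn (mulChart E G) (mulDom E G) := (smooth_mul_chart 1 1 1).2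

lemma isOpen_invDom : IsOpen (invDom E G) :=
  (chartAt E (1 : G)).isOpen_inter_preimage_symm
    ((chartAt E (1 : G)).open_source.preimage (LCLieGroup.smooth_inv (E := E) (G := G)).1)

lemma smooth_invChart : IsSmoothOn (invChart E G) (invDom E G) :=
  (LCLieGroup.smooth_inv (E := E) (G := G)).2 _ (chart_mem_atlas E 1) _ (chart_mem_atlas E 1)

lemma one_mem_invDom : chartAt E (1 : G) 1 ∈ invDom E G :=
  ⟨one_chart_mem, by simp [mem_chart_source]⟩

/-- On `invDom` the chart can be inverted after inversion, so `divChart` factors through `mulChart`.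
Openness and smoothness are then inherited from multiplication and inversion. -/
lemma divDom_eq : divDom E G = (invDom E G ×ˢ univ) ∩
    (fun q : E × E => (invChart E G q.1, q.2)) ⁻¹' mulDom E G := by
  ext ⟨u, v⟩
  simp only [divDom, mulDom, invChart, mem_ofPred_eq, mem_inter_iff, mem_prod, mem_univ, and_true,
    mem_preimage]
  refine and_congr_right fun hu => ?_
  rw [(chartAt E (1 : G)).left_inv hu.2]
  exact ⟨fun h => ⟨(chartAt E (1 : G)).map_source hu.2, h⟩, fun h => h.2⟩

lemma smooth_inv_snd : IsSmoothOn (fun q : E × E => (invChart E G q.1, q.2))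
    (invDom E G ×ˢ (univ : Set E)) :=
  (smooth_invChart.comp isOpen_invDom (isSmoothOn_fst _) fun _ hq => hq.1).prodMk
    (isSmoothOn_snd _)

lemma isOpen_divDom : IsOpen (divDom E G) := by
  rw [divDom_eq]
  exact smooth_inv_snd.continuousOn.isOpen_inter_preimage (isOpen_invDom.prod isOpen_univ)
    isOpen_mulDom

lemma smooth_divChart : IsSmoothOn (divChart E G) (divDom E G) := by
  have h : IsSmoothOn (fun q : E × E => mulChart E G (invChart E G q.1, q.2)) (divDom E G) :=
    smooth_mulChart.comp isOpen_mulDom (smooth_inv_snd.mono fun q hq => ⟨hq.1, mem_univ _⟩)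
      fun q hq => by rw [divDom_eq] at hq; exact hq.2
  refine h.congr isOpen_divDom fun q hq => ?_
  simp only [mulChart, invChart, divChart, (chartAt E (1 : G)).left_inv hq.1.2]

/-- The intermediate product `u⁻¹ v` must also lie in the chart domain, so that `conjChart` factors
as `mulChart` after `divChart`. -/
lemma conjDom_eq : conjDom E G = divDom E G ∩
    (fun q : E × E => (divChart E G q, q.1)) ⁻¹' mulDom E G := by
  ext ⟨u, v⟩
  simp only [conjDom, mulDom, divChart, mem_ofPred_eq, mem_inter_iff, mem_preimage]
  refine and_congr_right fun hu => ?_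
  rw [(chartAt E (1 : G)).left_inv hu.2.2]
  exact ⟨fun h => ⟨(chartAt E (1 : G)).map_source hu.2.2, hu.1.1, h⟩, fun h => h.2.2⟩

lemma smooth_div_fst : IsSmoothOn (fun q : E × E => (divChart E G q, q.1)) (divDom E G) :=
  smooth_divChart.prodMk (isSmoothOn_fst _)

lemma isOpen_conjDom : IsOpen (conjDom E G) := by
  rw [conjDom_eq]
  exact smooth_div_fst.continuousOn.isOpen_inter_preimage isOpen_divDom isOpen_mulDom

lemma smooth_conjChart : IsSmoothOn (conjChart E G) (conjDom E G) := by
  have h : IsSmoothOn (fun q : E × E => mulChart E G (divChart E G q, q.1)) (conjDom E G) :=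
    smooth_mulChart.comp isOpen_mulDom (smooth_div_fst.mono fun q hq => hq.1)
      fun q hq => by rw [conjDom_eq] at hq; exact hq.2
  refine h.congr isOpen_conjDom fun q hq => ?_
  simp only [mulChart, conjChart, divChart, (chartAt E (1 : G)).left_inv hq.1.2.2]

lemma one_mem_conjDom {u : E} (hu : u ∈ invDom E G) : (u, chartAt E (1 : G) 1) ∈ conjDom E G :=
  ⟨⟨hu, one_chart_mem, by simpa using hu.2⟩, by simp [mem_chart_source]⟩

lemma diag_mem_divDom {u : E} (hu : u ∈ invDom E G) : (u, u) ∈ divDom E G :=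
  ⟨hu, hu.1, by simp [mem_chart_source]⟩

/-- Partial derivatives. -/
lemma hasDirDeriv_snd {F : Type*} [AddCommGroup F] [Module ℝ F] [TopologicalSpace F]
    {f : E × E → F} {f' : F} {u v x : E} (h : HasDirDeriv f f' (u, v) (0, x)) :
    HasDirDeriv (fun y => f (u, y)) f' v x :=
  h.comp_affine (L := fun y => (u, y)) fun t => by simp

lemma hasDirDeriv_fst {F : Type*} [AddCommGroup F] [Module ℝ F] [TopologicalSpace F]
    {f : E × E → F} {f' : F} {u v x : E} (h : HasDirDeriv f f' (u, v) (x, 0)) :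
    HasDirDeriv (fun y => f (y, v)) f' u x :=
  h.comp_affine (L := fun y => (y, v)) fun t => by simp

/-- This exhibits `Ad(u)⁻¹ x` as a partial derivative of one map smooth in both variables, whence
its smooth dependence on `u`. -/
lemma hasDirDeriv_conjChart {u : E} (hu : u ∈ invDom E G) (x : E) :
    HasDirDeriv (fun v => conjChart E G (u, v)) (AdFun E G ((chartAt E (1 : G)).symm u)⁻¹ x)
      (chartAt E (1 : G) 1) x := by
  have h := hasDirDeriv_snd (smooth_conjChart.hasDirDeriv (one_mem_conjDom hu) (0, x))
  have h' : AdFun E G ((chartAt E (1 : G)).symm u)⁻¹ x =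
      dirDeriv (fun v => conjChart E G (u, v)) (chartAt E (1 : G) 1) x := by
    simp only [AdFun, inv_inv, conjChart]
  rw [h', h.dirDeriv_eq]
  exact h

/-- The map `(u, x) ↦ Ad(u)⁻¹ x` is smooth. -/
lemma smooth_adInv : IsSmoothOn
    (fun q : E × E => AdFun E G ((chartAt E (1 : G)).symm q.1)⁻¹ q.2) (invDom E G ×ˢ univ) := by
  have h : IsSmoothOn (fun q : E × E => dirDeriv (conjChart E G) (q.1, chartAt E (1 : G) 1)
      (0, q.2)) (invDom E G ×ˢ univ) :=
    IsSmoothOn.comp (g := fun r : (E × E) × (E × E) => dirDeriv (conjChart E G) r.1 r.2)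
      (f := fun q : E × E => ((q.1, chartAt E (1 : G) 1), ((0 : E), q.2)))
      (smooth_conjChart.dirDeriv isOpen_conjDom) (isOpen_conjDom.prod isOpen_univ)
      (((isSmoothOn_fst _).prodMk (isSmoothOn_const _ _)).prodMk
        ((isSmoothOn_const _ _).prodMk (isSmoothOn_snd _)))
      fun q hq => ⟨one_mem_conjDom hq.1, mem_univ _⟩
  refine h.congr (isOpen_invDom.prod isOpen_univ) fun q hq => ?_
  exact ((hasDirDeriv_snd
    (smooth_conjChart.hasDirDeriv (one_mem_conjDom hq.1) (0, q.2))).unique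
    (hasDirDeriv_conjChart hq.1 q.2))

variable (E G) in
/-- The left logarithmic derivative in the chart at `1`. -/
noncomputable def logDeriv (u w : E) : E := dirDeriv (fun v => divChart E G (u, v)) u w

lemma hasDirDeriv_divChart {u : E} (hu : u ∈ invDom E G) (w : E) :
    HasDirDeriv (fun v => divChart E G (u, v)) (logDeriv E G u w) u w := by
  have h := hasDirDeriv_snd (smooth_divChart.hasDirDeriv (diag_mem_divDom hu) (0, w))
  rw [logDeriv, h.dirDeriv_eq]
  exact h

lemma smooth_logDeriv : IsSmoothOn (fun q : E × E => logDeriv E G q.1 q.2)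
    (invDom E G ×ˢ univ) := by
  have h : IsSmoothOn (fun q : E × E => dirDeriv (divChart E G) (q.1, q.1)
      (0, q.2)) (invDom E G ×ˢ univ) :=
    IsSmoothOn.comp (g := fun r : (E × E) × (E × E) => dirDeriv (divChart E G) r.1 r.2)
      (f := fun q : E × E => ((q.1, q.1), ((0 : E), q.2)))
      (smooth_divChart.dirDeriv isOpen_divDom) (isOpen_divDom.prod isOpen_univ)
      (((isSmoothOn_fst _).prodMk (isSmoothOn_fst _)).prodMk
        ((isSmoothOn_const _ _).prodMk (isSmoothOn_snd _)))
      fun q hq => ⟨diag_mem_divDom hq.1, mem_univ _⟩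
  refine h.congr (isOpen_invDom.prod isOpen_univ) fun q hq => ?_
  exact ((hasDirDeriv_snd
    (smooth_divChart.hasDirDeriv (diag_mem_divDom hq.1) (0, q.2))).unique
    (hasDirDeriv_divChart hq.1 q.2))

/-! ### The derivative of the adjoint action -/

lemma mem_mulDom_left {u : E} (hu : u ∈ (chartAt E (1 : G)).target) :
    (u, chartAt E (1 : G) 1) ∈ mulDom E G :=
  ⟨hu, one_chart_mem, by simpa using (chartAt E (1 : G)).map_target hu⟩

lemma mem_mulDom_right {u : E} (hu : u ∈ (chartAt E (1 : G)).target) :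
    (chartAt E (1 : G) 1, u) ∈ mulDom E G :=
  ⟨one_chart_mem, hu, by simpa using (chartAt E (1 : G)).map_target hu⟩

lemma leftInvField_eq {u : E} (hu : u ∈ (chartAt E (1 : G)).target) (x : E) :
    leftInvField E G x u = dirDeriv (mulChart E G) (u, chartAt E (1 : G) 1) (0, x) :=
  (hasDirDeriv_snd (smooth_mulChart.hasDirDeriv (mem_mulDom_left hu) (0, x))).dirDeriv_eq

lemma leftInvField_one (x : E) : leftInvField E G x (chartAt E (1 : G) 1) = x := by
  have h := (hasDirDeriv_clm (ContinuousLinearMap.id ℝ E) (chartAt E (1 : G) 1) x)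
  refine HasDirDeriv.dirDeriv_eq (h.congr_eventually ?_)
  filter_upwards [(chartAt E (1 : G)).open_target.mem_nhds one_chart_mem] with v hv
  simp [(chartAt E (1 : G)).right_inv hv]

lemma smooth_dirDeriv_mulChart (w : E × E) :
    IsSmoothOn (fun q => dirDeriv (mulChart E G) q w) (mulDom E G) :=
  IsSmoothOn.comp (g := fun r : (E × E) × (E × E) => dirDeriv (mulChart E G) r.1 r.2)
    (f := fun q : E × E => (q, w)) (smooth_mulChart.dirDeriv isOpen_mulDom)
    (isOpen_mulDom.prod isOpen_univ) ((isSmoothOn_id _).prodMk (isSmoothOn_const _ _))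
    fun _ hq => ⟨hq, mem_univ _⟩

lemma hasDirDeriv_leftInvField (x y : E) :
    HasDirDeriv (leftInvField E G y) (dirDeriv (fun q => dirDeriv (mulChart E G) q (0, y))
      (chartAt E (1 : G) 1, chartAt E (1 : G) 1) (x, 0)) (chartAt E (1 : G) 1) x := by
  refine (hasDirDeriv_fst ((smooth_dirDeriv_mulChart (G := G) (0, y)).hasDirDeriv
    (mem_mulDom_left one_chart_mem) (x, 0))).congr_eventually ?_
  filter_upwards [(chartAt E (1 : G)).open_target.mem_nhds one_chart_mem] with v hv
  exact (leftInvField_eq hv y).symm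

/-- Near `1` the field `y_l` is the partial derivative of the multiplication in its second argument,
and its value at `1` is `y`. The bracket is thus the antisymmetrised mixed second derivative of the
multiplication. -/
lemma lieBracket_eq (x y : E) : lieBracket E G x y =
    dirDeriv (fun q => dirDeriv (mulChart E G) q (0, y))
      (chartAt E (1 : G) 1, chartAt E (1 : G) 1) (x, 0) -
    dirDeriv (fun q => dirDeriv (mulChart E G) q (0, x))
      (chartAt E (1 : G) 1, chartAt E (1 : G) 1) (y, 0) := by
  rw [lieBracket, leftInvField_one, leftInvField_one, (hasDirDeriv_leftInvField x y).dirDeriv_eq,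
    (hasDirDeriv_leftInvField y x).dirDeriv_eq]

/-- Differentiate the identity `u · (u⁻¹ v u) = v · u` in `v` at `1` in the direction `y`. -/
lemma mulChart_adInv {u : E} (hu : u ∈ invDom E G) (y : E) :
    dirDeriv (mulChart E G) (u, chartAt E (1 : G) 1)
      (0, AdFun E G ((chartAt E (1 : G)).symm u)⁻¹ y) =
    dirDeriv (mulChart E G) (chartAt E (1 : G) 1, u) (y, 0) := by
  have hval : conjChart E G (u, chartAt E (1 : G) 1) = chartAt E (1 : G) 1 := by
    simp [conjChart]
  have h1 : HasDirDeriv (fun v => (u, conjChart E G (u, v)))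
      (0, AdFun E G ((chartAt E (1 : G)).symm u)⁻¹ y) (chartAt E (1 : G) 1) y :=
    (hasDirDeriv_const u _ _).prodMk (hasDirDeriv_conjChart hu y)
  have h2 := smooth_mulChart.chain isOpen_mulDom
    (by simp only [hval]; exact mem_mulDom_left hu.1) h1
  simp only [hval] at h2
  have h3 := hasDirDeriv_fst (smooth_mulChart.hasDirDeriv (mem_mulDom_right hu.1) (y, 0))
  refine h2.unique (h3.congr_eventually ?_)
  have hc : Tendsto (fun v : E => (u, v)) (𝓝 (chartAt E (1 : G) 1))
      (𝓝 (u, chartAt E (1 : G) 1)) := tendsto_const_nhds.prodMk_nhds tendsto_id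
  filter_upwards [hc.eventually (isOpen_conjDom.mem_nhds (one_mem_conjDom hu))] with v hv
  simp only [mulChart, conjChart, (chartAt E (1 : G)).left_inv hv.2]
  congr 1
  group

lemma smooth_adInv_left (y : E) : IsSmoothOn
    (fun u : E => AdFun E G ((chartAt E (1 : G)).symm u)⁻¹ y) (invDom E G) :=
  IsSmoothOn.comp (g := fun q : E × E => AdFun E G ((chartAt E (1 : G)).symm q.1)⁻¹ q.2)
    (f := fun u : E => (u, y)) smooth_adInv (isOpen_invDom.prod isOpen_univ)
    ((isSmoothOn_id _).prodMk (isSmoothOn_const y _)) fun _ hq => ⟨hq, mem_univ _⟩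

lemma AdFun_one (x : E) : AdFun E G (1 : G) x = x := by
  have h := (hasDirDeriv_clm (ContinuousLinearMap.id ℝ E) (chartAt E (1 : G) 1) x)
  refine HasDirDeriv.dirDeriv_eq (h.congr_eventually ?_)
  filter_upwards [(chartAt E (1 : G)).open_target.mem_nhds one_chart_mem] with v hv
  simp [(chartAt E (1 : G)).right_inv hv]

/-- The derivative of `u ↦ Ad(u)⁻¹ y` at `1` in the direction `x` is `[y, x]`. -/
lemma hasDirDeriv_adInv (x y : E) :
    HasDirDeriv (fun u : E => AdFun E G ((chartAt E (1 : G)).symm u)⁻¹ y) (lieBracket E G y x)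
      (chartAt E (1 : G) 1) x := by
  set e : E := chartAt E (1 : G) 1 with he
  have hA := (smooth_adInv_left (G := G) y).hasDirDeriv one_mem_invDom x
  set a := dirDeriv (fun u : E => AdFun E G ((chartAt E (1 : G)).symm u)⁻¹ y) e x with ha
  rw [← he] at hA
  suffices a = lieBracket E G y x by rw [← this]; exact hA
  have hAe : AdFun E G ((chartAt E (1 : G)).symm e)⁻¹ y = y := by
    rw [he, chart_symm_one, inv_one, AdFun_one]
  have hee : (e, e) ∈ mulDom E G := mem_mulDom_left one_chart_mem
  have hN := smooth_mulChart.dirDeriv (isOpen_mulDom (E := E) (G := G))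
  have hNo := (isOpen_mulDom (E := E) (G := G)).prod (isOpen_univ (X := E × E))
  have hmem : ∀ w : E × E, ((e, e), w) ∈ mulDom E G ×ˢ (univ : Set (E × E)) :=
    fun w => ⟨hee, mem_univ _⟩
  have h1 : HasDirDeriv
      (fun u => ((u, e), ((0 : E), AdFun E G ((chartAt E (1 : G)).symm u)⁻¹ y)))
      ((x, 0), (0, a)) e x :=
    ((hasDirDeriv_clm (ContinuousLinearMap.id ℝ E) e x).prodMk (hasDirDeriv_const e _ _)).prodMk
      ((hasDirDeriv_const (0 : E) _ _).prodMk hA)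
  -- Both sides of `mulChart_adInv` are now differentiated in `u` at `1` along `x`: `h2` treats the
  -- left side, `h3` the right side, and `h4` equates the results.
  have h2 := hN.chain hNo (by exact hmem _) h1
  simp only [hAe] at h2
  have h3 := hasDirDeriv_snd ((smooth_dirDeriv_mulChart (G := G) (y, 0)).hasDirDeriv hee (0, x))
  have h4 := h2.unique (h3.congr_eventually (by
    filter_upwards [isOpen_invDom.mem_nhds (one_mem_invDom (E := E) (G := G))] with u hu
    exact (mulChart_adInv hu y).symm))
  -- Moving the base point gives a mixed second derivative (`h6`). Moving the direction gives `a`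
  -- itself (`h8`), since multiplication at `(1, 1)` has identity derivative in its second argument.
  have h5 : ((x, (0 : E)), ((0 : E), a)) = ((x, 0), (0, 0)) + ((0, 0), (0, a)) := by simp
  rw [h5, hN.dirDeriv_add hNo (hmem _)] at h4
  have h6 : dirDeriv (fun q : (E × E) × (E × E) => dirDeriv (mulChart E G) q.1 q.2)
      ((e, e), (0, y)) ((x, 0), (0, 0)) =
      dirDeriv (fun q => dirDeriv (mulChart E G) q (0, y)) (e, e) (x, 0) := by
    have h7 := (hN.hasDirDeriv (hmem (0, y)) ((x, 0), (0, 0))).comp_affine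
      (L := fun q : E × E => (q, ((0 : E), y))) (x := (e, e)) (v := (x, 0)) fun t => by simp
    exact h7.dirDeriv_eq.symm
  have h8 : dirDeriv (fun q : (E × E) × (E × E) => dirDeriv (mulChart E G) q.1 q.2)
      ((e, e), (0, y)) ((0, 0), (0, a)) = a := by
    have h9 := (hN.hasDirDeriv (hmem (0, y)) ((0, 0), (0, a))).comp_affine
      (L := fun w : E => ((e, e), ((0 : E), w))) (x := y) (v := a) fun t => by simp
    refine h9.unique ((hasDirDeriv_clm (ContinuousLinearMap.id ℝ E) y a).congr_eventually ?_)
    filter_upwards with w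
    rw [← leftInvField_eq one_chart_mem, leftInvField_one]
    rfl
  -- Symmetry of the second derivative puts the right side into the form occurring in
  -- `lieBracket_eq`.
  rw [h6, h8, smooth_mulChart.dirDeriv_comm isOpen_mulDom hee (y, 0) (0, x)] at h4
  rw [lieBracket_eq, ← h4]
  abel

end Group

/-! ### Compatibility of `Ad`, the bracket and the derived action -/

section Naturality

variable {E G V : Type*} [AddCommGroup E] [Module ℝ E] [TopologicalSpace E]
  [IsTopologicalAddGroup E] [ContinuousSMul ℝ E] [LocallyConvexSpace ℝ E] [T2Space E]
  [TopologicalSpace G] [ChartedSpace E G] [Group G] [LCLieGroup E G]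

variable (E) in
/-- Conjugation by `g` in the chart at `1`. -/
def conjBy (g : G) (u : E) : E := chartAt E (1 : G) (g * (chartAt E (1 : G)).symm u * g⁻¹)

@[simp] lemma conjBy_one_chart (g : G) :
    conjBy E g (chartAt E (1 : G) 1) = chartAt E (1 : G) 1 := by
  simp [conjBy]

lemma isOpen_smooth_mul_left (g : G) :
    IsOpen {u : E | u ∈ (chartAt E (1 : G)).target ∧
      g * (chartAt E (1 : G)).symm u ∈ (chartAt E g).source} ∧
    IsSmoothOn (fun u : E => chartAt E g (g * (chartAt E (1 : G)).symm u))
      {u : E | u ∈ (chartAt E (1 : G)).target ∧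
        g * (chartAt E (1 : G)).symm u ∈ (chartAt E g).source} := by
  obtain ⟨ho, hs⟩ := smooth_mul_chart (E := E) g 1 g
  have hg := (chartAt E g).left_inv (mem_chart_source E g)
  have hopen : IsOpen {u : E | u ∈ (chartAt E (1 : G)).target ∧
      g * (chartAt E (1 : G)).symm u ∈ (chartAt E g).source} := by
    have h := ho.preimage (by fun_prop : Continuous (fun u : E => (chartAt E g g, u)))
    simpa [preimage, hg, mem_chart_target] using h
  refine ⟨hopen, ?_⟩
  have h := hs.comp (f := fun u : E => (chartAt E g g, u)) ho
    ((isSmoothOn_const _ _).prodMk (isSmoothOn_id _))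
    (U := {u : E | u ∈ (chartAt E (1 : G)).target ∧
      g * (chartAt E (1 : G)).symm u ∈ (chartAt E g).source})
    fun u hu => ⟨mem_chart_target E g, hu.1, by simpa only [hg] using hu.2⟩
  simpa only [hg] using h

lemma isOpen_smooth_mul_right (g h : G) :
    IsOpen {u : E | u ∈ (chartAt E g).target ∧
      (chartAt E g).symm u * h ∈ (chartAt E (1 : G)).source} ∧
    IsSmoothOn (fun u : E => chartAt E (1 : G) ((chartAt E g).symm u * h))
      {u : E | u ∈ (chartAt E g).target ∧
        (chartAt E g).symm u * h ∈ (chartAt E (1 : G)).source} := by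
  obtain ⟨ho, hs⟩ := smooth_mul_chart (E := E) g h 1
  have hg := (chartAt E h).left_inv (mem_chart_source E h)
  have hopen : IsOpen {u : E | u ∈ (chartAt E g).target ∧
      (chartAt E g).symm u * h ∈ (chartAt E (1 : G)).source} := by
    have h := ho.preimage (by fun_prop : Continuous (fun u : E => (u, chartAt E h h)))
    simpa [preimage, hg, mem_chart_target] using h
  refine ⟨hopen, ?_⟩
  have h := hs.comp (f := fun u : E => (u, chartAt E h h)) ho
    ((isSmoothOn_id _).prodMk (isSmoothOn_const _ _))
    (U := {u : E | u ∈ (chartAt E g).target ∧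
      (chartAt E g).symm u * h ∈ (chartAt E (1 : G)).source})
    fun u hu => ⟨hu.1, mem_chart_target E h, by simpa only [hg] using hu.2⟩
  simpa only [hg] using h

/-- Since `g` may lie outside the chart domain at `1`, conjugation is factored as left translation
into the chart at `g` followed by right translation by `g⁻¹` back to the chart at `1`. -/
lemma exists_smooth_conjBy (g : G) :
    ∃ U : Set E, IsOpen U ∧ chartAt E (1 : G) 1 ∈ U ∧ IsSmoothOn (conjBy E g) U ∧
      ∀ u ∈ U, (chartAt E (1 : G)).symm (conjBy E g u) = g * (chartAt E (1 : G)).symm u * g⁻¹ := by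
  obtain ⟨hLo, hLs⟩ := isOpen_smooth_mul_left (E := E) g
  obtain ⟨hRo, hRs⟩ := isOpen_smooth_mul_right (E := E) g g⁻¹
  have hUo := hLs.continuousOn.isOpen_inter_preimage hLo hRo
  refine ⟨_, hUo, ⟨⟨one_chart_mem, by simp [mem_chart_source]⟩, ?_⟩, ?_, ?_⟩
  · simp only [mem_preimage, chart_symm_one, mul_one]
    exact ⟨mem_chart_target E g, by
      rw [(chartAt E g).left_inv (mem_chart_source E g), mul_inv_cancel]
      exact mem_chart_source E 1⟩
  · refine (hRs.comp hRo (hLs.mono inter_subset_left) fun u hu => hu.2).congr hUo fun u hu => ?_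
    simp only [conjBy, (chartAt E g).left_inv hu.1.2]
  · intro u hu
    refine (chartAt E (1 : G)).left_inv ?_
    have h := hu.2.2
    rwa [(chartAt E g).left_inv hu.1.2] at h

lemma hasDirDeriv_conjBy (g : G) (x : E) :
    HasDirDeriv (conjBy E g) (AdFun E G g x) (chartAt E (1 : G) 1) x := by
  obtain ⟨U, hU, h1, hs, -⟩ := exists_smooth_conjBy (E := E) g
  exact hs.hasDirDeriv h1 x

lemma eventually_conjBy (g : G) : ∀ᶠ u in 𝓝 (chartAt E (1 : G) 1),
    (chartAt E (1 : G)).symm (conjBy E g u) = g * (chartAt E (1 : G)).symm u * g⁻¹ := by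
  obtain ⟨U, hU, h1, -, h⟩ := exists_smooth_conjBy (E := E) g
  filter_upwards [hU.mem_nhds h1] with u hu using h u hu

lemma AdFun_mul (g h : G) (x : E) : AdFun E G (g * h) x = AdFun E G g (AdFun E G h x) := by
  obtain ⟨U, hU, h1, hs, -⟩ := exists_smooth_conjBy (E := E) g
  have h2 := hs.chain hU (by rw [conjBy_one_chart]; exact h1) (hasDirDeriv_conjBy h x)
  rw [conjBy_one_chart] at h2
  refine HasDirDeriv.dirDeriv_eq (h2.congr_eventually ?_)
  filter_upwards [eventually_conjBy (E := E) h] with u hu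
  rw [conjBy, hu]
  congr 1
  group

/-- `Ad(g)` is a homomorphism of Lie algebras. -/
lemma AdFun_lieBracket (g : G) (x y : E) :
    AdFun E G g (lieBracket E G x y) = lieBracket E G (AdFun E G g x) (AdFun E G g y) := by
  -- Differentiate `Ad(g) Ad(u)⁻¹ x = Ad(g u g⁻¹)⁻¹ Ad(g) x` in `u` at `1` along `y`; `h1` and `h2`
  -- are the two sides.
  have h1 := (hasDirDeriv_adInv (G := G) y x).clm_comp (Ad E G g)
  have h2 := (smooth_adInv_left (G := G) (AdFun E G g x)).chain isOpen_invDom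
    (by rw [conjBy_one_chart]; exact one_mem_invDom) (hasDirDeriv_conjBy g y)
  rw [conjBy_one_chart, (hasDirDeriv_adInv _ _).dirDeriv_eq] at h2
  refine h1.unique (h2.congr_eventually ?_)
  filter_upwards [eventually_conjBy (E := E) g] with u hu
  change _ = AdFun E G g (AdFun E G ((chartAt E (1 : G)).symm u)⁻¹ x)
  rw [hu, ← AdFun_mul, ← AdFun_mul]
  congr 1
  group

lemma AdFun_inv_self (g : G) (x : E) : AdFun E G g (AdFun E G g⁻¹ x) = x := by
  rw [← AdFun_mul, mul_inv_cancel, AdFun_one]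

variable [AddCommGroup V] [Module ℝ V] [TopologicalSpace V]
  [IsTopologicalAddGroup V] [ContinuousSMul ℝ V] [LocallyConvexSpace ℝ V] [T2Space V]
  [DistribMulAction G V] [SMulCommClass G ℝ V] [SmoothModule E G V]

/-- The action in the chart at `1`. -/
lemma smooth_smul_chart : IsSmoothOn (fun q : E × V => (chartAt E (1 : G)).symm q.1 • q.2)
    ((chartAt E (1 : G)).target ×ˢ univ) := by
  have h := (SmoothModule.smooth_smul (E := E) (G := G) (V := V)).2
    ((chartAt E (1 : G)).prod (chartAt V (0 : V))) (chart_mem_atlas (E × V) ((1 : G), (0 : V)))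
    (chartAt V (0 : V)) (chart_mem_atlas V 0)
  refine (h.mono ?_).congr ((chartAt E (1 : G)).open_target.prod isOpen_univ) fun q _ => ?_
  · intro q hq
    simpa [chartAt_self_eq] using hq.1
  · simp [chartAt_self_eq]

lemma isOpen_target_prod : IsOpen ((chartAt E (1 : G)).target ×ˢ (univ : Set V)) :=
  (chartAt E (1 : G)).open_target.prod isOpen_univ

lemma smooth_orbit (v : V) : IsSmoothOn (fun u : E => (chartAt E (1 : G)).symm u • v)
    (chartAt E (1 : G)).target :=
  IsSmoothOn.comp (g := fun q : E × V => (chartAt E (1 : G)).symm q.1 • q.2)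
    (f := fun u : E => (u, v)) smooth_smul_chart isOpen_target_prod
    (fun _ => (isCkOn_clm (ContinuousLinearMap.id ℝ E) _).prodMk (isCkOn_const v _))
    fun _ hu => ⟨hu, mem_univ _⟩

lemma lieAct_eq (x : E) (v : V) : lieAct E G x v =
    dirDeriv (fun q : E × V => (chartAt E (1 : G)).symm q.1 • q.2) (chartAt E (1 : G) 1, v)
      (x, 0) := by
  have h := (smooth_smul_chart.hasDirDeriv (x := (chartAt E (1 : G) 1, v))
    ⟨one_chart_mem, mem_univ _⟩ (x, 0)).comp_affine (L := fun u : E => (u, v))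
      (x := chartAt E (1 : G) 1) (v := x) fun t => by simp
  exact h.dirDeriv_eq

/-- The derivative of `q ↦ q.1 • q.2` at `(1, v)`. -/
lemma dirDeriv_smul_chart (x : E) (v w : V) :
    dirDeriv (fun q : E × V => (chartAt E (1 : G)).symm q.1 • q.2) (chartAt E (1 : G) 1, v)
      (x, w) = lieAct E G x v + w := by
  have hm : (chartAt E (1 : G) 1, v) ∈ (chartAt E (1 : G)).target ×ˢ (univ : Set V) :=
    ⟨one_chart_mem, mem_univ _⟩
  have h := smooth_smul_chart.dirDeriv_add (isOpen_target_prod (E := E) (G := G)) hm (x, 0) (0, w)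
  rw [Prod.mk_add_mk, add_zero, zero_add, ← lieAct_eq] at h
  rw [h]
  congr 1
  have h2 := (smooth_smul_chart.hasDirDeriv hm ((0 : E), w)).comp_affine
    (L := fun z : V => (chartAt E (1 : G) 1, z)) (x := v) (v := w) fun t => by simp
  refine h2.unique ((hasDirDeriv_clm (ContinuousLinearMap.id ℝ V) v w).congr_eventually ?_)
  filter_upwards with z
  simp

variable (G V) in
/-- The operator `v ↦ x.v` on a smooth module. -/
noncomputable def lieActCLM (x : E) : V →L[ℝ] V where
  toFun := lieAct E G x
  map_add' := lieAct_add x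
  map_smul' := lieAct_smul x
  cont := by
    have h := (smooth_smul_chart.dirDeriv (isOpen_target_prod (E := E) (G := G)
      (V := V))).continuousOn.comp_continuous
      (by fun_prop : Continuous fun v : V => ((chartAt E (1 : G) 1, v), (x, (0 : V))))
      fun v => ⟨⟨one_chart_mem, mem_univ _⟩, mem_univ _⟩
    exact h.congr fun v => (lieAct_eq x v).symm

/-- Differentiate `g • (u • v) = (g u g⁻¹) • (g • v)` in `u` at `1` along `x`. -/
lemma smul_lieAct (g : G) (x : E) (v : V) :
    g • lieAct E G x v = lieAct E G (AdFun E G g x) (g • v) := by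
  have h1 := (exists_lieAct (G := G) x v).clm_comp (moduleOp E G V g)
  have h2 := (smooth_orbit (E := E) (G := G) (g • v)).chain (chartAt E (1 : G)).open_target
    (by rw [conjBy_one_chart]; exact one_chart_mem) (hasDirDeriv_conjBy g x)
  rw [conjBy_one_chart] at h2
  refine h1.unique (h2.congr_eventually ?_)
  filter_upwards [eventually_conjBy (E := E) g] with u hu
  change _ = g • ((chartAt E (1 : G)).symm u • v)
  rw [hu, smul_smul, smul_smul]
  congr 1
  group

end Naturality

/-! ### Equivariance of the differential and Cartan's formula -/

section Cartan

variable {E G V : Type*} [AddCommGroup E] [Module ℝ E] [TopologicalSpace E]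
  [IsTopologicalAddGroup E] [ContinuousSMul ℝ E] [LocallyConvexSpace ℝ E] [T2Space E]
  [TopologicalSpace G] [ChartedSpace E G] [Group G] [LCLieGroup E G]
  [AddCommGroup V] [Module ℝ V] [TopologicalSpace V]
  [IsTopologicalAddGroup V] [ContinuousSMul ℝ V] [LocallyConvexSpace ℝ V] [T2Space V]
  [DistribMulAction G V] [SMulCommClass G ℝ V] [SmoothModule E G V]

lemma cochainAct_apply {p : ℕ} (g : G) (ω : Cochain E G V p) (x : Fin p → E) :
    cochainAct E G V p g ω x = g • ω (fun i => AdFun E G g⁻¹ (x i)) := rfl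

lemma cochainAct_mul {p : ℕ} (g h : G) (ω : Cochain E G V p) :
    cochainAct E G V p (g * h) ω = cochainAct E G V p g (cochainAct E G V p h ω) := by
  ext x
  simp only [cochainAct_apply, mul_inv_rev, AdFun_mul, mul_smul]

lemma cochainAct_one {p : ℕ} (ω : Cochain E G V p) : cochainAct E G V p 1 ω = ω := by
  ext x
  simp only [cochainAct_apply, inv_one, AdFun_one, one_smul]

lemma bracketPart_cochainAct {p : ℕ} (g : G) (ω : Cochain E G V p) (x : Fin (p + 1) → E) :
    bracketPart E G V p (cochainAct E G V p g ω) x =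
      g • bracketPart E G V p ω (fun i => AdFun E G g⁻¹ (x i)) := by
  cases p with
  | zero => simp [bracketPart]
  | succ p =>
    simp only [bracketPart, Finset.smul_sum]
    refine Finset.sum_congr rfl fun i _ => Finset.sum_congr rfl fun j _ => ?_
    split_ifs
    · rw [cochainAct_apply, smul_comm g]
      congr 3
      funext k
      refine Fin.cases ?_ (fun k => ?_) k
      · simp [AdFun_lieBracket]
      · simp
    · simp

/-- The Chevalley-Eilenberg differential is equivariant. -/
lemma ceDiff_cochainAct {p : ℕ} (g : G) (ω : Cochain E G V p) (x : Fin (p + 1) → E) :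
    ceDiff E G V p (cochainAct E G V p g ω) x =
      g • ceDiff E G V p ω (fun i => AdFun E G g⁻¹ (x i)) := by
  simp only [ceDiff, LinearMap.coe_mk, AddHom.coe_mk, smul_add, bracketPart_cochainAct,
    Finset.smul_sum]
  congr 1
  refine Finset.sum_congr rfl fun i _ => ?_
  rw [smul_comm g, smul_lieAct, AdFun_inv_self, cochainAct_apply]

/-- The interior product of a cochain with `x`. -/
def interior {p : ℕ} (x : E) (ω : Cochain E G V (p + 1)) : Cochain E G V p :=
  { ω.toAlternatingMap.curryLeft x with
    cont := ω.cont.comp (continuous_pi fun i =>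
      Fin.cases continuous_const (fun j => continuous_apply j) i) }

lemma interior_apply {p : ℕ} (x : E) (ω : Cochain E G V (p + 1)) (y : Fin p → E) :
    interior (G := G) x ω y = ω (Fin.cons x y) := rfl

lemma cochain_cons_swap {p : ℕ} (ω : Cochain E G V (p + 2)) (a b : E) (z : Fin p → E) :
    ω (Fin.cons a (Fin.cons b z)) = - ω (Fin.cons b (Fin.cons a z)) := by
  have h := ω.toAlternatingMap.map_swap (Fin.cons b (Fin.cons a z) : Fin (p + 2) → E)
    (i := 0) (j := 1) (by simp)
  have e : (Fin.cons b (Fin.cons a z) : Fin (p + 2) → E) ∘ Equiv.swap (0 : Fin (p + 2)) 1 =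
      Fin.cons a (Fin.cons b z) := by
    funext k
    refine Fin.cases ?_ (fun k => Fin.cases ?_ (fun k => ?_) k) k
    · simp
    · rw [Function.comp_apply, Fin.succ_zero_eq_one, Equiv.swap_apply_right]
      rfl
    · rw [Function.comp_apply, Equiv.swap_apply_of_ne_of_ne (Fin.succ_ne_zero _)
        (by rw [← Fin.succ_zero_eq_one, Ne, Fin.succ_inj]; exact Fin.succ_ne_zero _)]
      rfl
  rw [e] at h
  exact h

lemma cochain_update {p : ℕ} (ω : Cochain E G V (p + 1)) (y : Fin (p + 1) → E) (j : Fin (p + 1))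
    (a : E) : ω (Function.update y j a) =
      (-1 : ℝ) ^ (j : ℕ) • ω (Fin.cons a fun k => y (j.succAbove k)) := by
  have h := ω.toAlternatingMap.map_insertNth j a fun k => y (j.succAbove k)
  have e : j.insertNth a (fun k => y (j.succAbove k)) = Function.update y j a :=
    Fin.insertNth_removeNth j a y
  rw [e] at h
  refine Eq.trans h ?_
  rw [← Int.cast_smul_eq_zsmul ℝ]
  push_cast
  rfl

/-- The pairs `a < b` are split according to whether `a = 0`. For `a = 0` the sign is `(-1)^{j+1}`,
and carrying the bracket back to slot `j` absorbs `(-1)^j`. For `a > 0` both indices shift by one,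
so the sign is unchanged, and exchanging the bracket with `x` gives the minus. -/
lemma bracketPart_cons {p : ℕ} (ω : Cochain E G V (p + 1)) (x : E) (y : Fin (p + 1) → E) :
    bracketPart E G V (p + 1) ω (Fin.cons x y) =
      - ∑ j, ω (Function.update y j (lieBracket E G x (y j))) -
        bracketPart E G V p (interior x ω) y := by
  -- When `a > 0`, the choice `j = 0` makes the second index `0`, which violates `a < b`; this
  -- summand drops out.
  have h0 : ∀ i : Fin (p + 1), ¬ i.succ < i.succ.succAbove 0 := fun i => by
    rw [Fin.succ_succAbove_zero]; exact Fin.not_lt_zero _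
  rw [bracketPart, Fin.sum_univ_succ (n := p + 1), sub_eq_add_neg, ← Finset.sum_neg_distrib]
  congr 1
  · refine Finset.sum_congr rfl fun j _ => ?_
    simp only [Fin.zero_succAbove, Fin.succ_pos, if_true, Fin.cons_zero, Fin.cons_succ,
      Fin.val_zero, Fin.val_succ, zero_add, pow_succ, cochain_update, mul_neg, mul_one, neg_smul]
  · cases p with
    | zero => simp [bracketPart]
    | succ p =>
      rw [bracketPart, ← Finset.sum_neg_distrib]
      refine Finset.sum_congr rfl fun i _ => ?_
      rw [Fin.sum_univ_succ (n := p + 1), if_neg (h0 i), zero_add, ← Finset.sum_neg_distrib]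
      refine Finset.sum_congr rfl fun j _ => ?_
      simp only [Fin.succ_succAbove_succ, Fin.succ_lt_succ_iff, Fin.cons_succ]
      split_ifs
      · rw [interior_apply, cochain_cons_swap, smul_neg, neg_neg]
        have e : (fun k : Fin (p + 1) => (Fin.cons x y : Fin (p + 3) → E)
            (i.succ.succAbove (j.succ.succAbove k))) =
            Fin.cons x fun k : Fin p => y (i.succAbove (j.succAbove k)) := by
          funext k
          refine Fin.cases ?_ (fun k => ?_) k
          · simp
          · simp
        rw [e]
        congr 1
        simp only [Fin.val_succ]
        ring
      · simp

/-- Cartan's formula for the Lie derivative of a cocycle. -/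
lemma ceDiff_interior {p : ℕ} {ω : Cochain E G V (p + 1)} (hω : ceDiff E G V (p + 1) ω = 0)
    (x : E) (y : Fin (p + 1) → E) : ceDiff E G V p (interior x ω) y =
      lieAct E G x (ω y) - ∑ j, ω (Function.update y j (lieBracket E G x (y j))) := by
  -- The cocycle identity at `(x, y)` consists of `x.ω(y)`, the bracket terms containing `x`, and
  -- the negative of all terms of `d(i_x ω)(y)`.
  have h := congrFun hω (Fin.cons x y)
  simp only [ceDiff, LinearMap.coe_mk, AddHom.coe_mk, bracketPart_cons, Pi.zero_apply] at h ⊢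
  rw [Fin.sum_univ_succ] at h
  simp only [Fin.val_zero, pow_zero, one_smul, Fin.cons_zero, Fin.zero_succAbove, Fin.cons_succ,
    Fin.val_succ, pow_succ, mul_neg, mul_one, neg_smul, Finset.sum_neg_distrib] at h
  have e : ∀ i : Fin (p + 1), (fun k : Fin (p + 1) => (Fin.cons x y : Fin (p + 2) → E)
      (i.succ.succAbove k)) = Fin.cons x fun k : Fin p => y (i.succAbove k) := by
    intro i
    funext k
    refine Fin.cases ?_ (fun k => ?_) k <;> simp
  simp only [e] at h
  simp only [interior_apply]
  rw [eq_comm, ← sub_eq_zero]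
  rw [← h]
  abel

end Cartan

/-! ### The orbit map of a cocycle, its integral, and connectedness -/

section Homotopy

variable {E G V : Type*} [AddCommGroup E] [Module ℝ E] [TopologicalSpace E]
  [IsTopologicalAddGroup E] [ContinuousSMul ℝ E] [LocallyConvexSpace ℝ E] [T2Space E]
  [TopologicalSpace G] [ChartedSpace E G] [Group G] [LCLieGroup E G]
  [AddCommGroup V] [Module ℝ V] [TopologicalSpace V]
  [IsTopologicalAddGroup V] [ContinuousSMul ℝ V] [LocallyConvexSpace ℝ V] [T2Space V]
  [DistribMulAction G V] [SMulCommClass G ℝ V] [SmoothModule E G V]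

lemma smooth_smul_cochain {D : Type*} [AddCommGroup D] [Module ℝ D] [TopologicalSpace D]
    [IsTopologicalAddGroup D] [ContinuousSMul ℝ D] {p : ℕ} (ω : Cochain E G V p) {f : D → E}
    {X : D → Fin p → E} {U : Set D} (hf : IsSmoothOn f U)
    (hm : MapsTo f U (chartAt E (1 : G)).target) (hX : IsSmoothOn X U) :
    IsSmoothOn (fun d => (chartAt E (1 : G)).symm (f d) • ω (X d)) U :=
  IsSmoothOn.comp (g := fun q : E × V => (chartAt E (1 : G)).symm q.1 • q.2)
    (f := fun d => (f d, ω (X d))) smooth_smul_chart isOpen_target_prod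
    (hf.prodMk ((isSmoothOn_multilinear ω.toContinuousMultilinearMap).comp isOpen_univ hX
      fun _ _ => mem_univ _)) fun _ hd => ⟨hm hd, mem_univ _⟩

/-- The orbit map of a cochain, evaluated at `x`, in the chart at `1`. -/
lemma smooth_cochainAct {p : ℕ} (ω : Cochain E G V p) (x : Fin p → E) :
    IsSmoothOn (fun u : E => cochainAct E G V p ((chartAt E (1 : G)).symm u) ω x)
      (invDom E G) :=
  smooth_smul_cochain ω (isSmoothOn_id _) (fun _ hu => hu.1)
    (IsSmoothOn.pi fun i => smooth_adInv_left (x i))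

/-- Product rule for `u • ω(Ad(u)⁻¹ x_1, …)`: one term from the action on `V`, one from each slot.
The result is the Lie derivative of `ω` along `d`. -/
lemma hasDirDeriv_cochainAct_one {p : ℕ} (ω : Cochain E G V p) (x : Fin p → E) (d : E) :
    HasDirDeriv (fun u : E => cochainAct E G V p ((chartAt E (1 : G)).symm u) ω x)
      (lieAct E G d (ω x) - ∑ i, ω (Function.update x i (lieBracket E G d (x i))))
      (chartAt E (1 : G) 1) d := by
  have h1 : HasDirDeriv (fun u : E => fun i => AdFun E G ((chartAt E (1 : G)).symm u)⁻¹ (x i))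
      (fun i => lieBracket E G (x i) d) (chartAt E (1 : G) 1) d :=
    HasDirDeriv.pi fun i => hasDirDeriv_adInv d (x i)
  have hx : (fun i => AdFun E G ((chartAt E (1 : G)).symm (chartAt E (1 : G) 1))⁻¹ (x i)) = x := by
    funext i
    rw [chart_symm_one, inv_one, AdFun_one]
  have h2 := (isSmoothOn_multilinear ω.toContinuousMultilinearMap).chain isOpen_univ
    (mem_univ _) h1
  rw [hx, (hasDirDeriv_multilinear ω.toContinuousMultilinearMap _ _).dirDeriv_eq] at h2
  have h3 := (hasDirDeriv_clm (ContinuousLinearMap.id ℝ E) (chartAt E (1 : G) 1) d).prodMk h2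
  have h4 := (smooth_smul_chart (E := E) (G := G) (V := V)).chain isOpen_target_prod
    (by exact ⟨one_chart_mem, mem_univ _⟩) h3
  simp only [ContinuousLinearMap.id_apply, hx, dirDeriv_smul_chart] at h4
  -- Differentiating `Ad(u)⁻¹` produces `[x_i, d]`; Cartan's formula is stated with `[d, x_i]`,
  -- which accounts for the minus sign.
  have h5 : ∑ i, ω.toContinuousMultilinearMap (Function.update x i (lieBracket E G (x i) d)) =
      - ∑ i, ω (Function.update x i (lieBracket E G d (x i))) := by
    rw [← Finset.sum_neg_distrib]
    refine Finset.sum_congr rfl fun i _ => ?_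
    rw [show lieBracket E G (x i) d = (-1 : ℝ) • lieBracket E G d (x i) by
      simp [lieBracket]]
    refine (ω.map_update_smul x i (-1 : ℝ) (lieBracket E G d (x i))).trans ?_
    rw [neg_one_smul]
  rw [h5, ← sub_eq_add_neg] at h4
  exact h4

/-- Writing `v.ω = u.((u⁻¹ v).ω)` reduces this to the derivative at `1`, since `v ↦ u⁻¹ v` passes
through `1` at `v = u` with derivative `logDeriv`. -/
lemma hasDirDeriv_cochainAct {p : ℕ} (ω : Cochain E G V p) (x : Fin p → E) {u : E}
    (hu : u ∈ invDom E G) (w : E) {y : Fin p → E}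
    (hy : y = fun i => AdFun E G ((chartAt E (1 : G)).symm u)⁻¹ (x i)) :
    HasDirDeriv (fun u : E => cochainAct E G V p ((chartAt E (1 : G)).symm u) ω x)
      ((chartAt E (1 : G)).symm u • (lieAct E G (logDeriv E G u w) (ω y) -
        ∑ i, ω (Function.update y i (lieBracket E G (logDeriv E G u w) (y i))))) u w := by
  have hval : divChart E G (u, u) = chartAt E (1 : G) 1 := by simp [divChart]
  have h1 := (smooth_cochainAct ω y).chain isOpen_invDom
    (by rw [hval]; exact one_mem_invDom) (hasDirDeriv_divChart hu w)
  rw [hval, (hasDirDeriv_cochainAct_one ω y _).dirDeriv_eq] at h1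
  refine (h1.clm_comp (moduleOp E G V ((chartAt E (1 : G)).symm u))).congr_eventually ?_
  have hc : Tendsto (fun v : E => (u, v)) (𝓝 u) (𝓝 (u, u)) :=
    tendsto_const_nhds.prodMk_nhds tendsto_id
  filter_upwards [hc.eventually (isOpen_divDom.mem_nhds (diag_mem_divDom hu))] with v hv
  rw [divChart, (chartAt E (1 : G)).left_inv hv.2.2, hy]
  change cochainAct E G V p _ (cochainAct E G V p _ ω) x = _
  rw [← cochainAct_mul, mul_inv_cancel_left]

/-- Fundamental theorem of calculus along a segment. -/
lemma isCurveIntegral_of_hasDirDeriv {f : E → V} {d : ℝ → V} {z w : E}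
    (hf : ∀ t ∈ Icc (0 : ℝ) 1, HasDirDeriv f (d t) (z + t • w) w)
    (hd : ContinuousOn d (Icc 0 1)) : IsCurveIntegral d (f (z + w) - f z) := by
  intro l
  rw [intervalIntegral.integral_eq_sub_of_hasDerivAt
    (f := fun r : ℝ => l (f (z + r • w))) (fun t ht => ?_) (intervalIntegrable_clm hd l)]
  · simp
  · rw [uIcc_of_le zero_le_one] at ht
    exact (hf t ht).hasDerivAt_comp l

/-- The derivative may be given by any expression `d`: uniqueness identifies it with `dirDeriv`, and
its continuity comes from smoothness of the orbit map. -/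
lemma isCurveIntegral_cochainAct {p : ℕ} (ω : Cochain E G V p) (x : Fin p → E) {w : E}
    (hw : ∀ t ∈ Icc (0 : ℝ) 1, chartAt E (1 : G) 1 + t • w ∈ invDom E G) {d : ℝ → V}
    (hd : ∀ t ∈ Icc (0 : ℝ) 1,
      HasDirDeriv (fun u : E => cochainAct E G V p ((chartAt E (1 : G)).symm u) ω x) (d t)
        (chartAt E (1 : G) 1 + t • w) w) :
    IsCurveIntegral d (cochainAct E G V p
      ((chartAt E (1 : G)).symm (chartAt E (1 : G) 1 + w)) ω x - ω x) := by
  have hs := smooth_cochainAct (G := G) ω x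
  have h := isCurveIntegral_of_hasDirDeriv hd (by
    have h1 : ContinuousOn (fun t : ℝ => dirDeriv
        (fun u : E => cochainAct E G V p ((chartAt E (1 : G)).symm u) ω x)
        (chartAt E (1 : G) 1 + t • w) w) (Icc 0 1) :=
      (hs.dirDeriv isOpen_invDom).continuousOn.comp
        (f := fun t : ℝ => (chartAt E (1 : G) 1 + t • w, w)) (by fun_prop)
        fun t ht => ⟨hw t ht, mem_univ _⟩
    exact h1.congr fun t ht => ((hd t ht).dirDeriv_eq).symm)
  rwa [chart_symm_one, cochainAct_one] at h

/-- Joint smoothness serves twice: along a segment it yields smooth curves that can be integrated,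
and jointly with the arguments it yields continuity of the integrated cochain. -/
lemma smooth_interior {p : ℕ} (ω : Cochain E G V (p + 1)) (w : E) :
    IsSmoothOn (fun q : E × (Fin p → E) => cochainAct E G V p ((chartAt E (1 : G)).symm q.1)
      (interior (logDeriv E G q.1 w) ω) q.2) (invDom E G ×ˢ univ) := by
  have hX : ∀ i : Fin (p + 1), IsSmoothOn (fun q : E × (Fin p → E) =>
      (Fin.cons (logDeriv E G q.1 w)
        (fun j => AdFun E G ((chartAt E (1 : G)).symm q.1)⁻¹ (q.2 j)) : Fin (p + 1) → E) i)
      (invDom E G ×ˢ univ) := by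
    intro i
    refine Fin.cases ?_ (fun j => ?_) i
    · exact IsSmoothOn.comp (g := fun q : E × E => logDeriv E G q.1 q.2)
        (f := fun q : E × (Fin p → E) => (q.1, w)) smooth_logDeriv
        (isOpen_invDom.prod isOpen_univ) ((isSmoothOn_fst _).prodMk (isSmoothOn_const w _))
        fun q hq => ⟨hq.1, mem_univ _⟩
    · exact IsSmoothOn.comp
        (g := fun q : E × E => AdFun E G ((chartAt E (1 : G)).symm q.1)⁻¹ q.2)
        (f := fun q : E × (Fin p → E) => (q.1, q.2 j)) smooth_adInv
        (isOpen_invDom.prod isOpen_univ) ((isSmoothOn_fst _).prodMk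
          (isSmoothOn_clm ((ContinuousLinearMap.proj (R := ℝ) (φ := fun _ : Fin p => E) j).comp
            (ContinuousLinearMap.snd ℝ E (Fin p → E))) _))
        fun q hq => ⟨hq.1, mem_univ _⟩
  exact smooth_smul_cochain ω (isSmoothOn_fst _) (fun q hq => hq.1.1) (IsSmoothOn.pi hX)

/-- The Chevalley-Eilenberg differential commutes with integrals. -/
lemma isCurveIntegral_ceDiff {p : ℕ} {η : ℝ → Cochain E G V p} {I : Cochain E G V p}
    (hc : ∀ y, ContinuousOn (fun t => η t y) (Icc 0 1))
    (hI : ∀ y, IsCurveIntegral (fun t => η t y) (I y)) (x : Fin (p + 1) → E) :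
    IsCurveIntegral (fun t => ceDiff E G V p (η t) x) (ceDiff E G V p I x) := by
  have hb : ContinuousOn (fun t => bracketPart E G V p (η t) x) (Icc 0 1) ∧
      IsCurveIntegral (fun t => bracketPart E G V p (η t) x) (bracketPart E G V p I x) := by
    cases p with
    | zero => exact ⟨continuousOn_const, isCurveIntegral_zero⟩
    | succ p =>
      have h1 : ∀ (i : Fin (p + 2)) (j : Fin (p + 1)), ContinuousOn (fun t =>
          if i < i.succAbove j then (-1 : ℝ) ^ ((i : ℕ) + (i.succAbove j : ℕ)) •
            η t (Fin.cons (lieBracket E G (x i) (x (i.succAbove j)))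
              (fun k : Fin p => x (i.succAbove (j.succAbove k)))) else 0) (Icc 0 1) := by
        intro i j
        split_ifs
        · exact (hc _).const_smul _
        · exact continuousOn_const
      refine ⟨continuousOn_finsetSum _ fun i _ => continuousOn_finsetSum _ fun j _ => h1 i j,
        IsCurveIntegral.sum _ (fun i _ => continuousOn_finsetSum _ fun j _ => h1 i j)
          fun i _ => IsCurveIntegral.sum _ (fun j _ => h1 i j) fun j _ => ?_⟩
      split_ifs
      · exact (hI _).const_smul _
      · exact isCurveIntegral_zero
  have h2 : ∀ i : Fin (p + 1), ContinuousOn (fun t => (-1 : ℝ) ^ (i : ℕ) •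
      lieAct E G (x i) (η t (fun k : Fin p => x (i.succAbove k)))) (Icc 0 1) := fun i =>
    ((lieActCLM G V (x i)).continuous.comp_continuousOn (hc _)).const_smul _
  exact (IsCurveIntegral.sum _ (fun i _ => h2 i) fun i _ =>
    ((hI _).clm_comp (lieActCLM G V (x i))).const_smul _).add
      (continuousOn_finsetSum _ fun i _ => h2 i) hb.1 hb.2

lemma cochainAct_sub_mem_of_segment (hV : MackeyComplete V) {p : ℕ} {ω : Cochain E G V p}
    (hω : ω ∈ cocycles E G V p) {w : E}
    (hw : ∀ t ∈ Icc (0 : ℝ) 1, chartAt E (1 : G) 1 + t • w ∈ invDom E G) :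
    cochainAct E G V p ((chartAt E (1 : G)).symm (chartAt E (1 : G) 1 + w)) ω - ω ∈
      coboundaries E G V p := by
  have hω' : ceDiff E G V p ω = 0 := hω
  cases p with
  | zero =>
    -- As `B^0 = 0`, the equality `g.ω = ω` is needed exactly. A `0`-cocycle is annihilated by the
    -- derived action, so its orbit map has derivative zero along the segment.
    have h0 : ∀ (d : E) (y : Fin 0 → E), lieAct E G d (ω y) = 0 := by
      intro d y
      have h := congrFun hω' fun _ => d
      simp only [ceDiff, LinearMap.coe_mk, AddHom.coe_mk, bracketPart, Fin.sum_univ_succ,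
        Fin.sum_univ_zero, Fin.val_zero, pow_zero, one_smul, add_zero, Pi.zero_apply] at h
      rw [← h]
      congr 2
      exact Subsingleton.elim _ _
    have h1 : cochainAct E G V 0 ((chartAt E (1 : G)).symm (chartAt E (1 : G) 1 + w)) ω - ω
        = 0 := by
      ext x
      refine IsCurveIntegral.unique (isCurveIntegral_cochainAct ω x hw (d := fun _ => 0)
        fun t ht => ?_) isCurveIntegral_zero
      have h2 := hasDirDeriv_cochainAct ω x (hw t ht) w rfl
      rw [h0] at h2
      simpa using h2
    rw [h1]
    exact zero_mem _
  | succ p =>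
    set c : ℝ → E := fun t => chartAt E (1 : G) 1 + t • w with hcdef
    have hcc : Continuous c := by fun_prop
    have hUo : IsOpen (c ⁻¹' invDom E G) := isOpen_invDom.preimage hcc
    set η : ℝ → Cochain E G V p := fun t => cochainAct E G V p ((chartAt E (1 : G)).symm (c t))
      (interior (logDeriv E G (c t) w) ω) with hη
    have hcont : ContinuousOn (fun q : ℝ × (Fin p → E) => η q.1 q.2) (Icc 0 1 ×ˢ univ) :=
      (smooth_interior ω w).continuousOn.comp
        (f := fun q : ℝ × (Fin p → E) => (c q.1, q.2)) (by fun_prop)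
        fun q hq => ⟨hw _ hq.1, mem_univ _⟩
    have hsm : ∀ y, IsSmoothOn (fun t => η t y) (c ⁻¹' invDom E G) := fun y =>
      IsSmoothOn.comp (f := fun t : ℝ => (c t, y)) (smooth_interior ω w)
        (isOpen_invDom.prod isOpen_univ)
        ((isSmoothOn_add_smul _ _ _).prodMk (isSmoothOn_const y _))
        fun t ht => ⟨ht, mem_univ _⟩
    obtain ⟨I, hI⟩ := exists_alternating_integral η hcont
      fun y => hV _ ((hsm y).isSmoothCurve hUo fun t ht => hw t ht)
    refine ⟨I, funext fun x => ?_⟩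
    -- Both `d I` and `g.ω - ω`, evaluated at `x`, are weak integrals of the same curve `t ↦ d(η
    -- t)(x)`; uniqueness identifies them.
    refine (isCurveIntegral_ceDiff (fun y => (hsm y).continuousOn.mono fun t ht => hw t ht)
      hI x).unique (isCurveIntegral_cochainAct ω x hw fun t ht => ?_)
    have h2 := hasDirDeriv_cochainAct ω x (hw t ht) w rfl
    rw [← ceDiff_interior hω', ← ceDiff_cochainAct] at h2
    exact h2

lemma cochainAct_mem_cocycles {p : ℕ} (g : G) {ω : Cochain E G V p}
    (hω : ω ∈ cocycles E G V p) : cochainAct E G V p g ω ∈ cocycles E G V p := by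
  have hω' : ceDiff E G V p ω = 0 := hω
  change ceDiff E G V p _ = 0
  funext x
  rw [ceDiff_cochainAct, hω', Pi.zero_apply, smul_zero, Pi.zero_apply]

lemma cochainAct_mem_coboundaries {p : ℕ} (g : G) {ω : Cochain E G V p}
    (hω : ω ∈ coboundaries E G V p) : cochainAct E G V p g ω ∈ coboundaries E G V p := by
  cases p with
  | zero =>
    have h : ω = 0 := hω
    rw [h, map_zero]
    exact zero_mem _
  | succ p =>
    obtain ⟨η, hη⟩ := hω
    refine ⟨cochainAct E G V p g η, funext fun x => ?_⟩
    rw [ceDiff_cochainAct, hη, cochainAct_apply]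

variable (E G V) in
/-- The subgroup of the elements that act trivially on the cohomology in degree `p`. -/
def trivialSubgroup (p : ℕ) : Subgroup G where
  carrier := {g | ∀ ω ∈ cocycles E G V p, cochainAct E G V p g ω - ω ∈ coboundaries E G V p}
  one_mem' ω _ := by rw [cochainAct_one, sub_self]; exact zero_mem _
  -- `gh.ω - ω = g.(h.ω - ω) + (g.ω - ω)`.
  mul_mem' {g h} hg hh ω hω := by
    have h1 := add_mem (cochainAct_mem_coboundaries g (hh ω hω)) (hg ω hω)
    rwa [map_sub, ← cochainAct_mul, sub_add_sub_cancel] at h1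
  -- `g⁻¹.ω - ω = -g⁻¹.(g.ω - ω)`.
  inv_mem' {g} hg ω hω := by
    have h1 := neg_mem (cochainAct_mem_coboundaries g⁻¹ (hg ω hω))
    rwa [map_sub, ← cochainAct_mul, inv_mul_cancel, cochainAct_one, neg_sub] at h1

lemma trivialSubgroup_eq_top [ConnectedSpace G] (hV : MackeyComplete V) (p : ℕ) :
    trivialSubgroup E G V p = ⊤ := by
  have := isTopologicalGroup E (G := G)
  have hmem : ((trivialSubgroup E G V p : Subgroup G) : Set G) ∈ 𝓝 (1 : G) := by
    -- Convexity of `C` keeps the segment from the chart image of `1` to that of `g` inside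
    -- `invDom`.
    obtain ⟨C, ⟨hC, hCc⟩, hCs⟩ := (LocallyConvexSpace.convex_basis (𝕜 := ℝ)
      (chartAt E (1 : G) 1)).mem_iff.1 (isOpen_invDom.mem_nhds one_mem_invDom)
    have h1 := ((chartAt E (1 : G)).continuousAt (mem_chart_source E (1 : G))) hC
    filter_upwards [h1, (chartAt E (1 : G)).open_source.mem_nhds (mem_chart_source E (1 : G))]
      with g hg hgs ω hω
    have h2 := cochainAct_sub_mem_of_segment hV hω (w := chartAt E (1 : G) g - chartAt E (1 : G) 1)
      fun t ht => hCs (hCc.add_smul_sub_mem (mem_of_mem_nhds hC) hg ht)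
    rwa [add_sub_cancel, (chartAt E (1 : G)).left_inv hgs] at h2
  have hopen := Subgroup.isOpen_of_mem_nhds _ hmem
  exact SetLike.coe_injective (IsClopen.eq_univ ⟨Subgroup.isClosed_of_isOpen _ hopen, hopen⟩
    ⟨1, one_mem _⟩)

end Homotopy

end LCLie

theorem mainTheorem11 (E G V : Type*)
    -- the model space of `G`, a Hausdorff locally convex space
    [AddCommGroup E] [Module ℝ E] [TopologicalSpace E] [IsTopologicalAddGroup E]
    [ContinuousSMul ℝ E] [LocallyConvexSpace ℝ E] [T2Space E]
    -- a connected Lie group `G` modelled on `E`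
    [TopologicalSpace G] [ChartedSpace E G] [Group G] [LCLie.LCLieGroup E G] [ConnectedSpace G]
    -- a Mackey complete smooth `G`-module `V`, a Hausdorff locally convex space
    [AddCommGroup V] [Module ℝ V] [TopologicalSpace V] [IsTopologicalAddGroup V]
    [ContinuousSMul ℝ V] [LocallyConvexSpace ℝ V] [T2Space V]
    [DistribMulAction G V] [SMulCommClass G ℝ V] [LCLie.SmoothModule E G V]
    (hV : LCLie.MackeyComplete V) (p : ℕ) (g : G) :
    -- the action of `g` on cochains preserves cocycles and coboundaries, and the map that it
    -- induces on `H^p(L(G), V) = Z^p / B^p` is the identity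
    ∃ (hZ : ∀ ω ∈ LCLie.cocycles E G V p,
        LCLie.cochainAct E G V p g ω ∈ LCLie.cocycles E G V p)
      (hB : (LCLie.coboundaries E G V p).submoduleOf (LCLie.cocycles E G V p) ≤
        ((LCLie.coboundaries E G V p).submoduleOf (LCLie.cocycles E G V p)).comap
          ((LCLie.cochainAct E G V p g).restrict hZ)),
      (Submodule.mapQ _ _ ((LCLie.cochainAct E G V p g).restrict hZ) hB :
        LCLie.Cohomology E G V p →ₗ[ℝ] LCLie.Cohomology E G V p) = LinearMap.id := by
  refine ⟨fun ω hω => LCLie.cochainAct_mem_cocycles g hω,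
    fun ω hω => LCLie.cochainAct_mem_coboundaries g hω, ?_⟩
  refine Submodule.linearMap_qext _ (LinearMap.ext fun ω => ?_)
  have hg : g ∈ LCLie.trivialSubgroup E G V p := by
    rw [LCLie.trivialSubgroup_eq_top hV p]
    exact Subgroup.mem_top g
  exact (Submodule.Quotient.eq _).2 (hg ω.1 ω.2)
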